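/- **Notation.** For $x>0$ and $\alpha,\alpha',\beta,\beta',\gamma\in\mathbb C$ with $\operatorname{Re}(\gamma)>0$, the left-sided Marichev–Saigo–Maeda fractional integral is $$\left(\mathcal I_{0+}^{\alpha,\alpha',\beta,\beta',\gamma}f\right)(x)=\frac{x^{-\alpha}}{\Gamma(\gamma)}\int_0^x(x-t)^{\gamma-1}t^{-\alpha'}F_3\!\left(\alpha,\alpha',\beta,\beta';\gamma;1-\tfrac tx,1-\tfrac xt\right)f(t)\,dt,$$ where $F_3(\alpha,\alpha',\beta,\beta';\gamma;u;v)=\sum_{k,l\ge0}\frac{(\alpha)_k(\alpha')_l(\beta)_k(\beta')_l}{(\gamma)_{k+l}}\frac{u^kv^l}{k!\,l!}$ for $|u|,|v|<1$, and, for $|u|<1$ and other $v$, $F_3$ is the analytic continuation of this series in $v$ along the straight segment from $0$ to $v$. Let $m,n,p,q$ be integers with $0\le m\le q$, $0\le n\le p$, let $a_i,b_j\in\mathbb C$ and $A_i,\alpha_i,B_j,\beta_j>0$ ($1\le i\le p$, $1\le j\le q$), and put $$\chi(s)=\frac{\prod_{j=1}^{m}\Gamma^{\beta_j}(b_j+B_js)\prod_{i=1}^{n}\Gamma^{\alpha_i}(1-a_i-A_is)}{\prod_{j=m+1}^{q}\Gamma^{\beta_j}(1-b_j-B_js)\prod_{i=n+1}^{p}\Gamma^{\alpha_i}(a_i+A_is)},$$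 where $\Gamma^{r}=\exp(r\log\Gamma)$ for an arbitrary fixed determination of $\log\Gamma$ (and $1/\Gamma^{r}=0$ at the poles of $\Gamma$). The $I$-function with the imaginary axis as its contour is $$I^{m,n}_{p,q}\!\left[z\,\middle|\begin{matrix}(a_i,A_i,\alpha_i)_{1,p}\\(b_j,B_j,\beta_j)_{1,q}\end{matrix}\right]=\frac1{2\pi i}\int_{-i\infty}^{i\infty}\chi(s)z^{-s}\,ds\qquad(z\ne0,\ z^{-s}\text{ principal}).$$ The data are called admissible if the singularities of $\Gamma(b_j+B_js)$, $1\le j\le m$, all lie in $\operatorname{Re}(s)<0$ and those of $\Gamma(1-a_i-A_is)$, $1\le i\le n$, all lie in $\operatorname{Re}(s)>0$. **Theorem.** Let $\alpha,\alpha',\beta,\beta',\gamma,\rho,a\in\mathbb C$, $a\neq0$, and $\mu\in\mathbb R$ be such that $\operatorname{Re}(\gamma)>0$, $\mu>0$ and $$\operatorname{Re}(\rho)>\max\{0,\operatorname{Re}(\alpha'-\beta'),\operatorname{Re}(\alpha+\alpha'+\beta-\gamma)\}.$$ Let the data $m,n,p,q,(a_i,A_i,\alpha_i),(b_j,B_j,\beta_j)$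 be admissible, and assume that the integral defining $I^{m,n}_{p,q}[at^\mu]$ converges absolutely for $t>0$. Then for every $x>0$ $$\left(\mathcal I_{0+}^{\alpha,\alpha',\beta,\beta',\gamma}\left(t^{\rho-1}I^{m,n}_{p,q}\!\left[at^{\mu}\,\middle|\begin{matrix}(a_i,A_i,\alpha_i)_{1,p}\\(b_j,B_j,\beta_j)_{1,q}\end{matrix}\right]\right)\right)(x)=x^{-\alpha-\alpha'+\gamma+\rho-1}\,I^{m,n+3}_{p+3,q+3}\!\left[ax^{\mu}\,\middle|\begin{matrix}U\\L\end{matrix}\right],$$ where the upper and lower parameter lists are $$U=\big((1-\rho,\mu,1),\ (1+\alpha'-\beta'-\rho,\mu,1),\ (1+\alpha+\alpha'+\beta-\gamma-\rho,\mu,1),\ (a_i,A_i,\alpha_i)_{1,p}\big),$$ $$L=\big((b_j,B_j,\beta_j)_{1,q},\ (1-\beta'-\rho,\mu,1),\ (1+\alpha+\alpha'-\gamma-\rho,\mu,1),\ (1+\alpha'+\beta-\gamma-\rho,\mu,1)\big).$$ Moreover, the integral over $(0,x)$ on the left-hand side converges absolutely, the data on the right-hand side are admissible, and the integral defining the $I$-function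 on the right-hand side converges absolutely. -/

import Mathlib

open Complex MeasureTheory Filter Topology

/-- `w` is the value at `y` of the analytic continuation of (the germ at `0` of) `f` along the
straight segment from `0` to `y`: some function, holomorphic on an open set that is star-shaped
about `0` and contains `y`, agrees with `f` near `0` and takes the value `w` at `y`. -/
def HasStarContinuation (f : ℂ → ℂ) (y w : ℂ) : Prop :=
  ∃ (U : Set ℂ) (F : ℂ → ℂ), IsOpen U ∧ StarConvex ℝ 0 U ∧ y ∈ U ∧
    DifferentiableOn ℂ F U ∧ F =ᶠ[𝓝 0] f ∧ F y = w

/-- The continued value does not depend on the choices made. -/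
theorem HasStarContinuation.unique {f : ℂ → ℂ} {y w₁ w₂ : ℂ}
    (h₁ : HasStarContinuation f y w₁) (h₂ : HasStarContinuation f y w₂) : w₁ = w₂ := by
  obtain ⟨U, F, hU, sU, yU, dF, eF, rfl⟩ := h₁
  obtain ⟨V, G, hV, sV, yV, dG, eG, rfl⟩ := h₂
  have s : StarConvex ℝ 0 (U ∩ V) := StarConvex.inter sU sV
  have ne : (U ∩ V).Nonempty := ⟨y, yU, yV⟩
  have zm : (0 : ℂ) ∈ U ∩ V := StarConvex.mem s ne
  have pc : IsPreconnected (U ∩ V) :=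
    (StarConvex.isPathConnected s zm).isConnected.isPreconnected
  have aF : AnalyticOnNhd ℂ F (U ∩ V) :=
    (dF.mono Set.inter_subset_left).analyticOnNhd (hU.inter hV)
  have aG : AnalyticOnNhd ℂ G (U ∩ V) :=
    (dG.mono Set.inter_subset_right).analyticOnNhd (hU.inter hV)
  exact aF.eqOn_of_preconnected_of_eventuallyEq aG pc zm (eF.trans eG.symm) ⟨yU, yV⟩

open Classical in
/-- Analytic continuation of `f` from the origin to `y` along the straight segment
(the value `0` is used where there is no such continuation). -/
noncomputable def starContinuation (f : ℂ → ℂ) (y : ℂ) : ℂ :=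
  if h : ∃ w, HasStarContinuation f y w then h.choose else 0

/-- The double power series of the third Appell function,
`∑ (α)ₘ (α')ₙ (β)ₘ (β')ₙ / (γ)ₘ₊ₙ · xᵐ yⁿ / (m! n!)`, convergent for `max (|x|, |y|) < 1`. -/
noncomputable def appellF3Series (α α' β β' γ x y : ℂ) : ℂ :=
  ∑' k : ℕ × ℕ,
    (ascPochhammer ℂ k.1).eval α * (ascPochhammer ℂ k.2).eval α' *
      (ascPochhammer ℂ k.1).eval β * (ascPochhammer ℂ k.2).eval β' /
        (ascPochhammer ℂ (k.1 + k.2)).eval γ *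
      (x ^ k.1 * y ^ k.2 / ((k.1.factorial : ℂ) * (k.2.factorial : ℂ)))

/-- The third Appell function `F₃(α, α', β, β'; γ; x; y)` for `|x| < 1`: the double series,
continued analytically in `y` from the unit disc along rays from the origin. It is the double series
itself for `|y| < 1`. The continuation is needed in the kernel of the fractional integral,
where `x` is `1 - t/x ∈ (0, 1)` and `y` is `1 - x/t ∈ (-∞, 0)`. -/
noncomputable def appellF3 (α α' β β' γ x y : ℂ) : ℂ :=
  starContinuation (fun z => appellF3Series α α' β β' γ x z) y

/-- The integrand of the left-sided Marichev-Saigo-Maeda fractional integral. -/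
noncomputable def msmLeftIntegrand (α α' β β' γ : ℂ) (f : ℝ → ℂ) (x t : ℝ) : ℂ :=
  ((x - t : ℝ) : ℂ) ^ (γ - 1) * (t : ℂ) ^ (-α') *
    appellF3 α α' β β' γ (1 - (t : ℂ) / (x : ℂ)) (1 - (x : ℂ) / (t : ℂ)) * f t

/-- The left-sided Marichev-Saigo-Maeda fractional integral
`x^(-α) / Γ(γ) · ∫₀ˣ (x-t)^(γ-1) t^(-α') F₃(α, α', β, β'; γ; 1 - t/x, 1 - x/t) f(t) dt`. -/
noncomputable def msmLeft (α α' β β' γ : ℂ) (f : ℝ → ℂ) (x : ℝ) : ℂ :=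
  (x : ℂ) ^ (-α) / Complex.Gamma γ * ∫ t in (0 : ℝ)..x, msmLeftIntegrand α α' β β' γ f x t

/-- `ℓ` is a determination of `log Γ`: a choice, at every point that is not a pole of `Γ`,
of a logarithm of `Γ`. No continuity is asked for, so `ℓ` may be a continuous branch on
every path of interest, or the principal logarithm of `Γ`, and so on. -/
def IsLogGamma (ℓ : ℂ → ℂ) : Prop :=
  ∀ z : ℂ, (∀ k : ℕ, z ≠ -(k : ℂ)) → Complex.exp (ℓ z) = Complex.Gamma z

open Classical in
/-- The power `Γ^r(z) = exp (r log Γ(z))` with real exponent `r`, for the determination `ℓ` of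
`log Γ`. At the poles of `Γ` it is set to `0`, so that there `1 / Γ^r(z)` is `0`, as it should be
for `r > 0`. -/
noncomputable def gammaPow (ℓ : ℂ → ℂ) (r : ℝ) (z : ℂ) : ℂ :=
  if ∃ k : ℕ, z = -(k : ℂ) then 0 else Complex.exp ((r : ℂ) * ℓ z)

/-- A parameter triple `(a, A, α)` of the `I`-function. -/
structure ITriple where
  shift : ℂ
  slope : ℝ
  power : ℝ

/-- The Mellin-Barnes kernel `χ(s)` of the `I`-function of order `(m, n; p, q)`, with upper
parameters `up i = (aᵢ, Aᵢ, αᵢ)` and lower parameters `lo j = (bⱼ, Bⱼ, βⱼ)`: the first `m` lower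
triples give factors `Γ^βⱼ(bⱼ + Bⱼ s)` of the numerator and the others factors
`Γ^βⱼ(1 - bⱼ - Bⱼ s)` of the denominator; the first `n` upper triples give factors
`Γ^αᵢ(1 - aᵢ - Aᵢ s)` of the numerator and the others factors `Γ^αᵢ(aᵢ + Aᵢ s)` of the
denominator. (Indices in `Fin` start at `0`, so `i < n` describes the first `n` of them.) -/
noncomputable def iKernel (ℓ : ℂ → ℂ) (m n : ℕ) {p q : ℕ}
    (up : Fin p → ITriple) (lo : Fin q → ITriple) (s : ℂ) : ℂ :=
  (∏ j : Fin q,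
    if j.val < m then gammaPow ℓ (lo j).power ((lo j).shift + (lo j).slope * s)
    else (gammaPow ℓ (lo j).power (1 - (lo j).shift - (lo j).slope * s))⁻¹) *
  ∏ i : Fin p,
    if i.val < n then gammaPow ℓ (up i).power (1 - (up i).shift - (up i).slope * s)
    else (gammaPow ℓ (up i).power ((up i).shift + (up i).slope * s))⁻¹

/-- The data are admissible for the `I`-function with contour `Re s = c`: the order satisfies
`m ≤ q`, `n ≤ p`, slopes and powers are positive, and the contour separates the singularities of
the two groups of numerator factors (in particular none of them coincide): those of
`Γ(bⱼ + Bⱼ s)` lie to its left, those of `Γ(1 - aᵢ - Aᵢ s)` to its right. -/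
structure IAdmissible (m n : ℕ) {p q : ℕ} (up : Fin p → ITriple) (lo : Fin q → ITriple)
    (c : ℝ) : Prop where
  le_q : m ≤ q
  le_p : n ≤ p
  up_slope_pos : ∀ i, 0 < (up i).slope
  up_power_pos : ∀ i, 0 < (up i).power
  lo_slope_pos : ∀ j, 0 < (lo j).slope
  lo_power_pos : ∀ j, 0 < (lo j).power
  left : ∀ j : Fin q, (j : ℕ) < m → ∀ (k : ℕ) (s : ℂ),
    (lo j).shift + (lo j).slope * s = -(k : ℂ) → s.re < c
  right : ∀ i : Fin p, (i : ℕ) < n → ∀ (k : ℕ) (s : ℂ),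
    1 - (up i).shift - (up i).slope * s = -(k : ℂ) → c < s.re

/-- The integrand `χ(s) z^(-s)` of the `I`-function at the point `s = c + i τ` of the contour. -/
noncomputable def iIntegrand (ℓ : ℂ → ℂ) (m n : ℕ) {p q : ℕ}
    (up : Fin p → ITriple) (lo : Fin q → ITriple) (c : ℝ) (z : ℂ) (τ : ℝ) : ℂ :=
  iKernel ℓ m n up lo ((c : ℂ) + (τ : ℂ) * I) * z ^ (-((c : ℂ) + (τ : ℂ) * I))

/-- The integral that defines the `I`-function converges absolutely at `z`. -/
def IConverges (ℓ : ℂ → ℂ) (m n : ℕ) {p q : ℕ}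
    (up : Fin p → ITriple) (lo : Fin q → ITriple) (c : ℝ) (z : ℂ) : Prop :=
  Integrable (iIntegrand ℓ m n up lo c z) volume

/-- The `I`-function of order `(m, n; p, q)`,
`1 / (2πi) · ∫_C χ(s) z^(-s) ds`, where `C` is the line `Re s = c` (so `ds = i dτ`). -/
noncomputable def iFunction (ℓ : ℂ → ℂ) (m n : ℕ) {p q : ℕ}
    (up : Fin p → ITriple) (lo : Fin q → ITriple) (c : ℝ) (z : ℂ) : ℂ :=
  1 / (2 * (Real.pi : ℂ) * I) * ∫ τ : ℝ, iIntegrand ℓ m n up lo c z τ * I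

/-! On the imaginary axis, the dependence of the `I`-function integrand on `t` is the unimodular
factor `t ^ (-μiτ)`. The double integral over `t` and `τ` is therefore dominated by a product of two
integrable functions, and Fubini reduces the theorem to the action of the fractional integral on `t
^ (σ - 1)` with `σ = ρ - μiτ`, where `Re σ = Re ρ`. That action (`integrableOn_msm_cpow`) produces
three Gamma factors over three others, which are the six adjoined parameter triples. Fubini also
gives both absolute convergence claims, so no asymptotics of the Mellin-Barnes kernel are needed.

For powers, Pfaff's transformation in the second variable of `F₃` sends `1 - x/t` to `1 - t/x`. Up
to a power of `t/x`, the kernel becomes a single power series in `1 - t/x` with coefficients `cₙ /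
(γ)ₙ` (`appellF3_kernel`). The transformed series also provides the analytic continuation. Termwise
beta integrals then give `Γ(γ) Γ(σ) ∑ cₙ / Γ(γ + σ + n)`.

This inverse factorial series is the diagonal regrouping of a double series that two applications of
Gauss's theorem sum (`hasSum_appellCoeff_mul_inv_Gamma`). Absolute convergence of the double series
needs a condition that the hypotheses do not supply. Its value, however, is symmetric in two
numerator and three denominator parameters. Since an inverse factorial series determines its
coefficients, the `cₙ` have the same symmetry, and for a suitable ordering of the parameters the
extra condition is automatic (`hasSum_kernelCoeff`). -/

/-! ### Rising factorials. -/

/-- The rising factorial `(z)ₙ = z (z + 1) ⋯ (z + n - 1)`. -/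
noncomputable def poch (z : ℂ) (n : ℕ) : ℂ := (ascPochhammer ℂ n).eval z

@[simp] lemma poch_zero (z : ℂ) : poch z 0 = 1 := by simp [poch]

lemma poch_succ (z : ℂ) (n : ℕ) : poch z (n + 1) = poch z n * (z + n) := by
  simp [poch, ascPochhammer_succ_eval]

lemma poch_add (z : ℂ) (k l : ℕ) : poch z (k + l) = poch z k * poch (z + k) l := by
  induction l with
  | zero => simp
  | succ l ih => rw [← add_assoc, poch_succ, ih, poch_succ]; push_cast; ring

lemma poch_succ_left (z : ℂ) (n : ℕ) : poch z (n + 1) = z * poch (z + 1) n := by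
  rw [add_comm, poch_add]; simp [poch_succ]

lemma poch_eq_prod (z : ℂ) (n : ℕ) : poch z n = ∏ j ∈ Finset.range n, (z + j) := by
  induction n with
  | zero => simp
  | succ n ih => rw [poch_succ, Finset.prod_range_succ, ih]

lemma ne_neg_nat_of_re_pos {z : ℂ} (hz : 0 < z.re) (k : ℕ) : z ≠ -(k : ℂ) := by
  rintro rfl
  simp at hz
  linarith [k.cast_nonneg (α := ℝ)]

lemma poch_ne_zero {z : ℂ} (hz : 0 < z.re) (n : ℕ) : poch z n ≠ 0 := by
  rw [poch_eq_prod, Finset.prod_ne_zero_iff]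
  intro j _ h
  exact ne_neg_nat_of_re_pos hz j (eq_neg_of_add_eq_zero_left h)

lemma Gamma_add_nat {z : ℂ} (hz : 0 < z.re) (n : ℕ) :
    Complex.Gamma (z + n) = poch z n * Complex.Gamma z := by
  rw [poch, ← Gamma_add_nat_div_Gamma_eq z (ne_neg_nat_of_re_pos hz),
    div_mul_cancel₀ _ (Gamma_ne_zero_of_re_pos hz)]

/-- A property of complex numbers that holds in the right half-plane and descends from `z + 1`
to `z` holds everywhere. -/
lemma of_re_pos_of_add_one {P : ℂ → Prop} (h₁ : ∀ z : ℂ, 0 < z.re → P z)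
    (h₂ : ∀ z, P (z + 1) → P z) (z : ℂ) : P z := by
  obtain ⟨N, hN⟩ := exists_nat_gt (-z.re)
  have key : ∀ n : ℕ, P (z + n) → P z := by
    intro n
    induction n with
    | zero => simp
    | succ n ih => intro h; exact ih (h₂ _ (by simpa [add_assoc] using h))
  exact key N (h₁ _ (by simp; linarith))

/-! ### Growth of rising factorials and of the reciprocal Gamma function. -/

/-- The size `n! (n + 1)^(x - 1)` of a rising factorial `(z)ₙ` with `Re z = x`. -/
noncomputable def pochSize (x : ℝ) (n : ℕ) : ℝ := n.factorial * ((n : ℝ) + 1) ^ (x - 1)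

lemma pochSize_pos (x : ℝ) (n : ℕ) : 0 < pochSize x n := by unfold pochSize; positivity

@[simp] lemma pochSize_zero (x : ℝ) : pochSize x 0 = 1 := by simp [pochSize]

lemma rpow_le_two_rpow_abs {u : ℝ} (h1 : 1 / 2 ≤ u) (h2 : u ≤ 2) (r : ℝ) :
    u ^ r ≤ 2 ^ |r| := by
  have hu : 0 < u := by linarith
  rcases le_total 0 r with hr | hr
  · rw [abs_of_nonneg hr]
    exact Real.rpow_le_rpow hu.le h2 hr
  · rw [abs_of_nonpos hr, Real.rpow_neg (by norm_num), ← Real.inv_rpow (by norm_num)]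
    exact Real.rpow_le_rpow_of_nonpos (by norm_num) (by linarith) hr

lemma pochSize_add_one_le (x : ℝ) (n : ℕ) :
    pochSize (x + 1) n ≤ 2 ^ |x - 1| * pochSize x (n + 1) := by
  have h := rpow_le_two_rpow_abs (u := ((n : ℝ) + 1) / (n + 2))
    (by rw [div_le_div_iff₀ (by norm_num) (by positivity)]; linarith [n.cast_nonneg (α := ℝ)])
    (by rw [div_le_iff₀ (by positivity)]; linarith [n.cast_nonneg (α := ℝ)]) (x - 1)
  rw [Real.div_rpow (by positivity) (by positivity), div_le_iff₀ (by positivity)] at h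
  have e : ((n : ℝ) + 1) ^ (x + 1 - 1) = (n + 1) ^ (x - 1) * (n + 1) := by
    rw [← Real.rpow_add_one (by positivity)]; ring_nf
  unfold pochSize
  rw [e, Nat.factorial_succ]
  push_cast
  rw [show (n : ℝ) + 1 + 1 = n + 2 by ring]
  calc _ = (n.factorial * ((n : ℝ) + 1)) * (n + 1) ^ (x - 1) := by ring
    _ ≤ (n.factorial * ((n : ℝ) + 1)) * (2 ^ |x - 1| * (n + 2) ^ (x - 1)) := by gcongr
    _ = _ := by ring

lemma pochSize_le_add_one (x : ℝ) (n : ℕ) :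
    pochSize x (n + 1) ≤ 2 ^ |x - 1| * pochSize (x + 1) n := by
  have h := rpow_le_two_rpow_abs (u := ((n : ℝ) + 2) / (n + 1))
    (by rw [div_le_div_iff₀ (by norm_num) (by positivity)]; linarith [n.cast_nonneg (α := ℝ)])
    (by rw [div_le_iff₀ (by positivity)]; linarith [n.cast_nonneg (α := ℝ)]) (x - 1)
  rw [Real.div_rpow (by positivity) (by positivity), div_le_iff₀ (by positivity)] at h
  have e : ((n : ℝ) + 1) ^ (x + 1 - 1) = (n + 1) ^ (x - 1) * (n + 1) := by
    rw [← Real.rpow_add_one (by positivity)]; ring_nf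
  unfold pochSize
  rw [e, Nat.factorial_succ]
  push_cast
  rw [show (n : ℝ) + 1 + 1 = n + 2 by ring]
  calc _ = (n.factorial * ((n : ℝ) + 1)) * (n + 2) ^ (x - 1) := by ring
    _ ≤ (n.factorial * ((n : ℝ) + 1)) * (2 ^ |x - 1| * (n + 1) ^ (x - 1)) := by gcongr
    _ = _ := by ring

/-- This is Euler's limit `n ^ z n! / (z)ₙ₊₁ → Γ(z)`, inverted; the product there has `n + 1`
factors, hence the shift of the index. -/
lemma tendsto_norm_poch_div_pochSize {z : ℂ} (hz : 0 < z.re) :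
    Tendsto (fun n : ℕ => ‖poch z n‖ / pochSize z.re n) atTop (𝓝 ‖Complex.Gamma z‖⁻¹) := by
  rw [← tendsto_add_atTop_iff_nat 1]
  have h1 := (GammaSeq_tendsto_Gamma z).norm.inv₀ (norm_ne_zero_iff.2 (Gamma_ne_zero_of_re_pos hz))
  have h2 : Tendsto (fun n : ℕ => (n : ℝ) / (n + 2)) atTop (𝓝 1) :=
    tendsto_natCast_div_add_atTop 2
  have h3 : Tendsto (fun n : ℕ => ((n : ℝ) + 2) / (n + 1)) atTop (𝓝 1) := by
    have := (tendsto_natCast_div_add_atTop (1 : ℝ)).const_mul (-1)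
    have := this.const_add 2
    norm_num at this
    refine this.congr fun n => ?_
    have : (n : ℝ) + 1 ≠ 0 := by positivity
    field_simp
    ring
  have h4 := (h1.mul ((h2.rpow_const (p := z.re) (by simp)).mul h3))
  simp only [Real.one_rpow, mul_one] at h4
  refine h4.congr' ?_
  filter_upwards [eventually_gt_atTop 0] with n hn
  have hn' : (0 : ℝ) < n := by exact_mod_cast hn
  have hp := norm_pos_iff.2 (poch_ne_zero hz (n + 1))
  rw [GammaSeq, ← poch_eq_prod, norm_div, norm_mul, norm_natCast_cpow_of_pos hn, norm_natCast,
    pochSize, Nat.factorial_succ, Real.div_rpow (by positivity) (by positivity)]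
  push_cast
  rw [show (n : ℝ) + 1 + 1 = n + 2 by ring, Real.rpow_sub_one (by positivity)]
  have : (0 : ℝ) < n.factorial := by positivity
  have : 0 < (n : ℝ) ^ z.re := by positivity
  have : 0 < ((n : ℝ) + 2) ^ z.re := by positivity
  field_simp

lemma exists_le_norm_poch {z : ℂ} (hz : 0 < z.re) :
    ∃ C : ℝ, 0 < C ∧ ∀ n, ‖poch z n‖ ≤ C * pochSize z.re n ∧ pochSize z.re n ≤ C * ‖poch z n‖ := by
  have h := tendsto_norm_poch_div_pochSize hz
  have hG : ‖Complex.Gamma z‖⁻¹ ≠ 0 :=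
    inv_ne_zero (norm_ne_zero_iff.2 (Gamma_ne_zero_of_re_pos hz))
  -- The ratio has a nonzero limit, so both it and its reciprocal are bounded.
  obtain ⟨C₁, hC₁⟩ := h.bddAbove_range
  obtain ⟨C₂, hC₂⟩ := (h.inv₀ hG).bddAbove_range
  refine ⟨max 1 (max C₁ C₂), by positivity, fun n => ?_⟩
  have hp := norm_pos_iff.2 (poch_ne_zero hz n)
  have hs := pochSize_pos z.re n
  have e1 := hC₁ ⟨n, rfl⟩
  have e2 := hC₂ ⟨n, rfl⟩
  simp only [inv_div] at e1 e2
  rw [div_le_iff₀ (by positivity)] at e1 e2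
  constructor
  · exact e1.trans (by gcongr; simp)
  · exact e2.trans (by gcongr; simp)

/-- The bound is uniform in `k` and `l`. For `Re z > 0` it comes from `(z)ₖ₊ₗ / (z)ₖ`. Elsewhere
`(z)ₖ` may vanish, so the bound descends from `z + 1` through `z + (k + 1) = (z + 1) + k`, with `k =
0` treated separately. -/
lemma exists_norm_poch_add_le (z : ℂ) :
    ∃ C : ℝ, 0 < C ∧ ∀ k l : ℕ,
      ‖poch (z + k) l‖ ≤ C * (pochSize z.re (k + l) / pochSize z.re k) := by
  induction z using of_re_pos_of_add_one with
  | h₁ z hz => ?_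
  | h₂ z hz => ?_
  · obtain ⟨C, hC, h⟩ := exists_le_norm_poch hz
    refine ⟨C * C, by positivity, fun k l => ?_⟩
    have hp := norm_pos_iff.2 (poch_ne_zero hz k)
    have e : ‖poch (z + k) l‖ = ‖poch z (k + l)‖ / ‖poch z k‖ := by
      rw [poch_add, norm_mul]; field_simp
    have hs := pochSize_pos z.re k
    have hs' := pochSize_pos z.re (k + l)
    rw [e, div_le_iff₀ hp]
    calc _ ≤ C * pochSize z.re (k + l) := (h _).1
      _ = C * (pochSize z.re (k + l) / pochSize z.re k) * pochSize z.re k := by field_simp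
      _ ≤ C * (pochSize z.re (k + l) / pochSize z.re k) * (C * ‖poch z k‖) := by
          gcongr; exact (h k).2
      _ = _ := by ring
  · obtain ⟨C, hC, h⟩ := hz
    simp only [add_re, one_re] at h
    set D : ℝ := 2 ^ |z.re - 1|
    have hD : 0 < D := by positivity
    refine ⟨1 + C * D * D + ‖z‖ * C * D, by positivity, fun k l => ?_⟩
    have hs := pochSize_pos z.re k
    have hs' := pochSize_pos z.re (k + l)
    set Q := pochSize z.re (k + l) / pochSize z.re k
    have hQ : 0 < Q := by positivity
    rcases k with _ | k
    · rcases l with _ | l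
      · simp only [poch_zero, norm_one]
        have : Q = 1 := by simp [Q]
        rw [this, mul_one, add_assoc]
        simp only [le_add_iff_nonneg_right]
        positivity
      · have h0 := h 0 l
        simp only [Nat.cast_zero, add_zero, zero_add, pochSize_zero, div_one] at h0
        have : Q = pochSize z.re (l + 1) := by simp [Q]
        rw [Nat.cast_zero, add_zero, poch_succ_left, norm_mul, this]
        have hp := pochSize_pos z.re (l + 1)
        calc _ ≤ ‖z‖ * (C * (D * pochSize z.re (l + 1))) := by
              gcongr; exact h0.trans (by gcongr; exact pochSize_add_one_le _ _)
          _ = (‖z‖ * C * D) * pochSize z.re (l + 1) := by ring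
          _ ≤ _ := by gcongr; simp only [le_add_iff_nonneg_left]; positivity
    · have h0 := h k l
      rw [show z + 1 + (k : ℂ) = z + ((k + 1 : ℕ) : ℂ) by push_cast; ring] at h0
      have hk := pochSize_pos (z.re + 1) k
      calc _ ≤ _ := h0
        _ ≤ C * ((D * pochSize z.re (k + l + 1)) / (pochSize z.re (k + 1) / D)) := by
            refine mul_le_mul_of_nonneg_left (div_le_div₀ ?_ ?_ (by positivity) ?_) hC.le
            · exact mul_nonneg hD.le (pochSize_pos _ _).le
            · exact pochSize_add_one_le _ _
            · rw [div_le_iff₀ hD, mul_comm]; exact pochSize_le_add_one _ _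
        _ = (C * D * D) * Q := by
            simp only [Q, show k + 1 + l = k + l + 1 by ring]; field_simp
        _ ≤ _ := by
            gcongr
            have : 0 ≤ ‖z‖ * C * D := by positivity
            linarith

lemma exists_norm_poch_le (z : ℂ) :
    ∃ C : ℝ, 0 < C ∧ ∀ n : ℕ, ‖poch z n‖ ≤ C * pochSize z.re n := by
  obtain ⟨C, hC, h⟩ := exists_norm_poch_add_le z
  exact ⟨C, hC, fun n => by simpa using h 0 n⟩

lemma exists_norm_inv_Gamma_add_le (z : ℂ) :
    ∃ C : ℝ, 0 < C ∧ ∀ n : ℕ, ‖(Complex.Gamma (z + n))⁻¹‖ ≤ C / pochSize z.re n := by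
  induction z using of_re_pos_of_add_one with
  | h₁ z hz => ?_
  | h₂ z hz => ?_
  · obtain ⟨C, hC, h⟩ := exists_le_norm_poch hz
    have hG := norm_pos_iff.2 (Gamma_ne_zero_of_re_pos hz)
    refine ⟨C / ‖Complex.Gamma z‖, by positivity, fun n => ?_⟩
    have hp := norm_pos_iff.2 (poch_ne_zero hz n)
    have hs := pochSize_pos z.re n
    rw [Gamma_add_nat hz, norm_inv, norm_mul, div_div, inv_eq_one_div,
      div_le_div_iff₀ (by positivity) (by positivity), one_mul]
    calc _ ≤ ‖Complex.Gamma z‖ * (C * ‖poch z n‖) := by gcongr; exact (h n).2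
      _ = _ := by ring
  · obtain ⟨C, hC, h⟩ := hz
    simp only [add_re, one_re] at h
    set D : ℝ := 2 ^ |z.re - 1|
    have hD : 0 < D := by positivity
    refine ⟨‖(Complex.Gamma z)⁻¹‖ + C * D, by positivity, fun n => ?_⟩
    rcases n with _ | n
    · simp only [Nat.cast_zero, add_zero, pochSize_zero, div_one, le_add_iff_nonneg_right]
      positivity
    · have h0 := h n
      rw [show z + 1 + (n : ℂ) = z + ((n + 1 : ℕ) : ℂ) by push_cast; ring] at h0
      have hs := pochSize_pos z.re (n + 1)
      have hs' := pochSize_pos (z.re + 1) n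
      calc _ ≤ _ := h0
        _ ≤ C / (pochSize z.re (n + 1) / D) := by
            gcongr
            rw [div_le_iff₀ hD, mul_comm]; exact pochSize_le_add_one _ _
        _ = (C * D) / pochSize z.re (n + 1) := by field_simp
        _ ≤ _ := by gcongr; simp

/-! ### Convergence of double series with power weights. -/

lemma summable_add_one_rpow {r : ℝ} (hr : r < -1) : Summable (fun n : ℕ => ((n : ℝ) + 1) ^ r) := by
  have := (summable_nat_add_iff 1).2 (Real.summable_nat_rpow.2 hr)
  simpa using this

/-- Used to divide the decay of `(k + l + 1) ^ r`, with `s = -r`, between the two indices so that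
each single series converges. -/
lemma exists_split {A B s : ℝ} (hs : 0 ≤ s) (hA : A < s) (hB : B < s) (hAB : A + B < s)
    (h0 : s = 0 → A < 0 ∧ B < 0) : ∃ θ, 0 ≤ θ ∧ θ ≤ 1 ∧ A < θ * s ∧ B < (1 - θ) * s := by
  rcases hs.eq_or_lt with rfl | hs
  · exact ⟨0, le_rfl, zero_le_one, by simpa using (h0 rfl).1, by simpa using (h0 rfl).2⟩
  · have h1 : max 0 (A / s) < min 1 (1 - B / s) := by
      rw [max_lt_iff, lt_min_iff, lt_min_iff, sub_pos, lt_sub_iff_add_lt, ← add_div,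
        div_lt_one hs, div_lt_one hs, div_lt_one hs]
      exact ⟨⟨one_pos, hB⟩, hA, hAB⟩
    obtain ⟨θ, h2, h3⟩ := exists_between h1
    rw [max_lt_iff] at h2
    rw [lt_min_iff] at h3
    refine ⟨θ, h2.1.le, h3.1.le, (div_lt_iff₀ hs).1 h2.2, (div_lt_iff₀ hs).1 (by linarith)⟩

lemma summable_rpow_mul_rpow_mul_rpow {p q r : ℝ} (hp : p + r < -1) (hq : q + r < -1)
    (hpq : p + q + r < -2) :
    Summable (fun k : ℕ × ℕ =>
      ((k.1 : ℝ) + 1) ^ p * ((k.2 : ℝ) + 1) ^ q * ((k.1 : ℝ) + k.2 + 1) ^ r) := by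
  have main : ∃ u v : ℝ, p + u < -1 ∧ q + v < -1 ∧
      ∀ x y : ℝ, 0 ≤ x → 0 ≤ y → (x + y + 1) ^ r ≤ (x + 1) ^ u * (y + 1) ^ v := by
    rcases le_total r 0 with hr | hr
    · obtain ⟨θ, h0, h1, h2, h3⟩ := exists_split (A := p + 1) (B := q + 1) (s := -r)
        (by linarith) (by linarith) (by linarith) (by linarith)
        (fun h => ⟨by linarith, by linarith⟩)
      refine ⟨θ * r, (1 - θ) * r, by linarith, by linarith, fun x y hx hy => ?_⟩
      calc (x + y + 1) ^ r = (x + y + 1) ^ (θ * r) * (x + y + 1) ^ ((1 - θ) * r) := by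
            rw [← Real.rpow_add (by positivity)]; ring_nf
        _ ≤ _ := by
            gcongr ?_ * ?_
            · exact Real.rpow_le_rpow_of_nonpos (by positivity) (by linarith)
                (mul_nonpos_of_nonneg_of_nonpos h0 hr)
            · exact Real.rpow_le_rpow_of_nonpos (by positivity) (by linarith)
                (mul_nonpos_of_nonneg_of_nonpos (by linarith) hr)
    -- For `r ≥ 0` no splitting is needed, since `x + y + 1 ≤ (x + 1) (y + 1)`.
    · refine ⟨r, r, hp, hq, fun x y hx hy => ?_⟩
      rw [← Real.mul_rpow (by positivity) (by positivity)]
      exact Real.rpow_le_rpow (by positivity) (by nlinarith [mul_nonneg hx hy]) hr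
  obtain ⟨u, v, hu, hv, h⟩ := main
  refine Summable.of_nonneg_of_le (fun _ => by positivity) (fun k => ?_)
    ((summable_add_one_rpow hu).mul_of_nonneg (summable_add_one_rpow hv)
      (fun _ => by positivity) (fun _ => by positivity))
  rw [Real.rpow_add (by positivity), Real.rpow_add (by positivity)]
  calc _ ≤ ((k.1 : ℝ) + 1) ^ p * ((k.2 : ℝ) + 1) ^ q *
        (((k.1 : ℝ) + 1) ^ u * ((k.2 : ℝ) + 1) ^ v) := by
        gcongr; exact h _ _ (by positivity) (by positivity)
    _ = _ := by ring

/-! ### Gauss's summation theorem. -/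

/-- The terms of the regularized Gauss hypergeometric series at `1`. -/
noncomputable def gaussTerm (a b c : ℂ) (k : ℕ) : ℂ :=
  poch a k * poch b k / k.factorial * (Complex.Gamma (c + k))⁻¹

lemma exists_norm_gaussTerm_le (a b c : ℂ) :
    ∃ C : ℝ, 0 < C ∧ ∀ k : ℕ,
      ‖gaussTerm a b c k‖ ≤ C * ((k : ℝ) + 1) ^ (a.re + b.re - c.re - 1) := by
  obtain ⟨A, hA, ha⟩ := exists_norm_poch_le a
  obtain ⟨B, hB, hb⟩ := exists_norm_poch_le b
  obtain ⟨C, hC, hc⟩ := exists_norm_inv_Gamma_add_le c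
  refine ⟨A * B * C, by positivity, fun k => ?_⟩
  have h1 := pochSize_pos a.re k
  have h2 := pochSize_pos b.re k
  have h3 := pochSize_pos c.re k
  rw [gaussTerm, norm_mul, norm_div, norm_mul, norm_natCast]
  calc _ ≤ (A * pochSize a.re k) * (B * pochSize b.re k) / k.factorial * (C / pochSize c.re k) := by
        gcongr
        · exact ha k
        · exact hb k
        · exact hc k
    _ = _ := by
        rw [show a.re + b.re - c.re - 1 = (a.re - 1) + (b.re - 1) - (c.re - 1) by ring,
          Real.rpow_sub (by positivity), Real.rpow_add (by positivity)]
        unfold pochSize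
        have : (0 : ℝ) < k.factorial := by positivity
        field_simp

lemma summable_norm_gaussTerm {a b c : ℂ} (h : 0 < (c - a - b).re) :
    Summable (fun k => ‖gaussTerm a b c k‖) := by
  obtain ⟨C, hC, hb⟩ := exists_norm_gaussTerm_le a b c
  simp only [sub_re] at h
  exact Summable.of_nonneg_of_le (fun _ => norm_nonneg _) hb
    ((summable_add_one_rpow (by linarith)).mul_left C)

/-- Since `Gamma` is `0` at its poles, `(Gamma z)⁻¹` is the entire function `1 / Γ` and there are no
exceptional points. This is the benefit of the regularized normalization. -/
lemma inv_Gamma_eq_mul (z : ℂ) : (Complex.Gamma z)⁻¹ = z * (Complex.Gamma (z + 1))⁻¹ :=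
  one_div_Gamma_eq_self_mul_one_div_Gamma_add_one z

lemma gaussTerm_eq_mul (a b c : ℂ) (k : ℕ) :
    gaussTerm a b c k = (c + k) * gaussTerm a b (c + 1) k := by
  rw [gaussTerm, gaussTerm, inv_Gamma_eq_mul (c + k), add_right_comm c 1]
  ring

lemma gaussTerm_succ (a b c : ℂ) (k : ℕ) :
    ((k + 1 : ℕ) : ℂ) * gaussTerm a b c (k + 1) = (a + k) * (b + k) * gaussTerm a b (c + 1) k := by
  rw [gaussTerm, gaussTerm, poch_succ, poch_succ, Nat.factorial_succ]
  have h1 : ((k + 1 : ℕ) : ℂ) ≠ 0 := Nat.cast_ne_zero.2 k.succ_ne_zero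
  have h2 : (k.factorial : ℂ) ≠ 0 := Nat.cast_ne_zero.2 k.factorial_ne_zero
  rw [Nat.cast_mul, show c + ((k + 1 : ℕ) : ℂ) = c + 1 + k by push_cast; ring]
  field_simp

/-- The termwise difference of the two sides telescopes: it is `G k - G (k + 1)` with `G k` equal to
`k` times the `k`-th term. Here `G 0 = 0`, and `G` tends to `0` because the terms are `O(k ^ (Re (a
+ b - c) - 1))`. -/
lemma tsum_gaussTerm_recurrence {a b c : ℂ} (h : 0 < (c - a - b).re) :
    (c - a - b) * ∑' k, gaussTerm a b c k =
      (c - a) * (c - b) * ∑' k, gaussTerm a b (c + 1) k := by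
  have h' : 0 < (c + 1 - a - b).re := by simp at h ⊢; linarith
  have s1 := (summable_norm_gaussTerm h).of_norm.hasSum
  have s2 := (summable_norm_gaussTerm h').of_norm.hasSum
  have s3 := ((s1.mul_left (c - a - b)).sub (s2.mul_left ((c - a) * (c - b)))).tendsto_sum_nat
  let G : ℕ → ℂ := fun k => k * gaussTerm a b c k
  have hG : ∀ k, (c - a - b) * gaussTerm a b c k - (c - a) * (c - b) * gaussTerm a b (c + 1) k =
      G k - G (k + 1) := by
    intro k
    simp only [G]
    rw [gaussTerm_succ, gaussTerm_eq_mul]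
    ring
  simp only [hG, Finset.sum_range_sub'] at s3
  have hG0 : Tendsto G atTop (𝓝 0) := by
    obtain ⟨C, hC, hb⟩ := exists_norm_gaussTerm_le a b c
    simp only [sub_re] at h
    have h0 : Tendsto (fun k : ℕ => C * ((k : ℝ) + 1) ^ (a.re + b.re - c.re)) atTop (𝓝 0) := by
      have := (tendsto_rpow_neg_atTop h).comp
        (tendsto_atTop_add_const_right _ (1 : ℝ) tendsto_natCast_atTop_atTop)
      have := this.const_mul C
      rw [mul_zero] at this
      refine this.congr fun k => ?_
      simp only [Function.comp]
      ring_nf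
    refine squeeze_zero_norm (fun k => ?_) h0
    simp only [G, norm_mul, norm_natCast]
    calc (k : ℝ) * ‖gaussTerm a b c k‖
        ≤ ((k : ℝ) + 1) * (C * ((k : ℝ) + 1) ^ (a.re + b.re - c.re - 1)) := by
          gcongr
          · linarith
          · exact hb k
      _ = _ := by rw [Real.rpow_sub_one (by positivity)]; field_simp
  have s4 := hG0.const_sub (G 0)
  have := tendsto_nhds_unique s3 s4
  simp only [G, Nat.cast_zero, zero_mul, sub_zero] at this
  exact sub_eq_zero.1 this

lemma norm_le_norm_add_of_re_nonneg {z : ℂ} (hz : 0 ≤ z.re) {t : ℝ} (ht : 0 ≤ t) :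
    ‖z‖ ≤ ‖z + t‖ := by
  rw [norm_def, norm_def]
  apply Real.sqrt_le_sqrt
  simp only [normSq_apply, add_re, ofReal_re, add_im, ofReal_im, add_zero]
  nlinarith [mul_nonneg hz ht]

lemma norm_poch_le_norm_poch_add {z : ℂ} (hz : 0 ≤ z.re) {t : ℝ} (ht : 0 ≤ t) (n : ℕ) :
    ‖poch z n‖ ≤ ‖poch (z + t) n‖ := by
  rw [poch_eq_prod, poch_eq_prod, norm_prod, norm_prod]
  refine Finset.prod_le_prod (fun _ _ => norm_nonneg _) fun j _ => ?_
  rw [add_right_comm]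
  exact norm_le_norm_add_of_re_nonneg (by simp; positivity) ht

/-- Every term but the first tends to `0`. The norm of `(c + N)ₖ` is at least that of `(c)ₖ`, so the
series for `N = 0` dominates. -/
lemma tendsto_gaussSum_shift {a b c : ℂ} (hc : 0 < c.re) (h : 0 < (c - a - b).re) :
    Tendsto (fun N : ℕ => ∑' k, poch a k * poch b k / k.factorial / poch (c + N) k)
      atTop (𝓝 1) := by
  have hlim : ∑' k, (if k = 0 then (1 : ℂ) else 0) = 1 := by simp
  rw [← hlim]
  have hs : Summable fun k => ‖poch a k * poch b k / k.factorial / poch c k‖ := by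
    refine ((summable_norm_gaussTerm h).mul_left ‖Complex.Gamma c‖).congr fun k => ?_
    have := norm_pos_iff.2 (Gamma_ne_zero_of_re_pos hc)
    have := norm_pos_iff.2 (poch_ne_zero hc k)
    rw [gaussTerm, Gamma_add_nat hc]
    simp only [norm_mul, norm_div, norm_inv]
    field_simp
  refine tendsto_tsum_of_dominated_convergence hs (fun k => ?_) (Eventually.of_forall fun N k => ?_)
  · rcases k with _ | k
    · simp
    · simp only [Nat.add_eq_zero_iff, one_ne_zero, and_false, if_false]
      set M : ℂ := poch a (k + 1) * poch b (k + 1) / (k + 1).factorial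
      have hp : 0 < ‖poch c k‖ := norm_pos_iff.2 (poch_ne_zero hc k)
      have h0 : Tendsto (fun N : ℕ => ‖M‖ / ‖poch c k‖ * (1 / (N : ℝ))) atTop (𝓝 0) := by
        simpa using (tendsto_one_div_atTop_nhds_zero_nat (𝕜 := ℝ)).const_mul (‖M‖ / ‖poch c k‖)
      refine squeeze_zero_norm' ?_ h0
      filter_upwards [eventually_gt_atTop 0] with N hN
      have hN' : (0 : ℝ) < N := by exact_mod_cast hN
      rw [poch_succ_left, norm_div, norm_mul, div_mul_div_comm, mul_one, mul_comm ‖poch c k‖]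
      gcongr
      · calc (N : ℝ) ≤ (c + N).re := by simp; exact hc.le
          _ ≤ _ := re_le_norm _
      · have := norm_poch_le_norm_poch_add hc.le (t := (N : ℝ) + 1) (by positivity) k
        push_cast at this
        rwa [← add_assoc] at this
  · simp only [norm_div]
    gcongr
    · exact norm_pos_iff.2 (poch_ne_zero hc k)
    · exact_mod_cast norm_poch_le_norm_poch_add hc.le (t := (N : ℝ)) (by positivity) k

lemma poch_mul_tsum_gaussTerm {a b c : ℂ} (h : 0 < (c - a - b).re) (N : ℕ) :
    poch (c - a - b) N * ∑' k, gaussTerm a b c k =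
      poch (c - a) N * poch (c - b) N * ∑' k, gaussTerm a b (c + N) k := by
  induction N with
  | zero => simp
  | succ N ih =>
    have h' : 0 < (c + N - a - b).re := by simp at h ⊢; linarith [N.cast_nonneg (α := ℝ)]
    have := tsum_gaussTerm_recurrence h'
    rw [poch_succ, poch_succ, poch_succ, Nat.cast_succ, ← add_assoc]
    calc _ = (c - a - b + N) * (poch (c - a - b) N * ∑' k, gaussTerm a b c k) := by ring
      _ = poch (c - a) N * poch (c - b) N *
          ((c + N - a - b) * ∑' k, gaussTerm a b (c + N) k) := by rw [ih]; ring
      _ = _ := by rw [this]; ring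

/-- Iterating the recurrence moves `c` to infinity, where the normalized sum tends to `1`. The
accumulated rising factorials form Euler's limits for the four Gamma factors; the powers of `N`
cancel because `(c - a - b) + c = (c - a) + (c - b)`. -/
lemma tsum_gaussTerm_of_re_pos {a b c : ℂ} (hc : 0 < c.re) (hca : 0 < (c - a).re)
    (hcb : 0 < (c - b).re) (h : 0 < (c - a - b).re) :
    ∑' k, gaussTerm a b c k =
      Complex.Gamma (c - a - b) * (Complex.Gamma (c - a))⁻¹ * (Complex.Gamma (c - b))⁻¹ := by
  have hG := Gamma_ne_zero_of_re_pos hc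
  have l1 := ((GammaSeq_tendsto_Gamma (c - a - b)).mul (GammaSeq_tendsto_Gamma c)).div
    ((GammaSeq_tendsto_Gamma (c - a)).mul (GammaSeq_tendsto_Gamma (c - b)))
    (mul_ne_zero (Gamma_ne_zero_of_re_pos hca) (Gamma_ne_zero_of_re_pos hcb))
  have l2 := l1.mul ((tendsto_add_atTop_iff_nat 1).2 (tendsto_gaussSum_shift hc h))
  have l3 : Tendsto (fun _ : ℕ => Complex.Gamma c * ∑' k, gaussTerm a b c k) atTop
      (𝓝 (Complex.Gamma c * ∑' k, gaussTerm a b c k)) := tendsto_const_nhds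
  have key := tendsto_nhds_unique l3 (l2.congr' ?_)
  · have : Complex.Gamma c * ∑' k, gaussTerm a b c k = Complex.Gamma c *
        (Complex.Gamma (c - a - b) * (Complex.Gamma (c - a))⁻¹ * (Complex.Gamma (c - b))⁻¹) := by
      rw [key]
      simp only [div_eq_mul_inv, mul_inv]
      ring
    exact mul_left_cancel₀ hG this
  · filter_upwards [eventually_gt_atTop 0] with N hN
    have hN' : (N : ℂ) ≠ 0 := by exact_mod_cast hN.ne'
    have r := poch_mul_tsum_gaussTerm h (N + 1)
    have e : ∑' k, gaussTerm a b (c + (N + 1 : ℕ)) k = (poch c (N + 1) * Complex.Gamma c)⁻¹ *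
        ∑' k, poch a k * poch b k / k.factorial / poch (c + (N + 1 : ℕ)) k := by
      rw [← tsum_mul_left]
      congr 1
      ext k
      have hcN : 0 < (c + (N + 1 : ℕ)).re := by simp; positivity
      rw [gaussTerm, Gamma_add_nat hcN, Gamma_add_nat hc]
      simp only [div_eq_mul_inv, mul_inv]
      ring
    rw [e] at r
    have p1 := poch_ne_zero hc (N + 1)
    have p2 := poch_ne_zero hca (N + 1)
    have p3 := poch_ne_zero hcb (N + 1)
    have p4 := poch_ne_zero h (N + 1)
    simp only [GammaSeq, ← poch_eq_prod]
    have hf : (N.factorial : ℂ) ≠ 0 := Nat.cast_ne_zero.2 N.factorial_ne_zero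
    have q1 : (N : ℂ) ^ (c - a - b) * (N : ℂ) ^ c = (N : ℂ) ^ (c - a) * (N : ℂ) ^ (c - b) := by
      rw [← cpow_add _ _ hN', ← cpow_add _ _ hN']; ring_nf
    have q2 : (N : ℂ) ^ (c - a) ≠ 0 := by simp [cpow_eq_zero_iff, hN']
    have q3 : (N : ℂ) ^ (c - b) ≠ 0 := by simp [cpow_eq_zero_iff, hN']
    set X := ∑' k, poch a k * poch b k / k.factorial / poch (c + (N + 1 : ℕ)) k
    have r' : Complex.Gamma c * ∑' k, gaussTerm a b c k =
        poch (c - a) (N + 1) * poch (c - b) (N + 1) * X /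
          (poch (c - a - b) (N + 1) * poch c (N + 1)) := by
      rw [eq_div_iff (mul_ne_zero p4 p1)]
      calc _ = Complex.Gamma c * poch c (N + 1) *
            (poch (c - a - b) (N + 1) * ∑' k, gaussTerm a b c k) := by ring
        _ = _ := by rw [r]; field_simp
    rw [r']
    simp only [Pi.div_apply]
    have q4 : (N : ℂ) ^ (c - a - b) * N.factorial / poch (c - a - b) (N + 1) *
        ((N : ℂ) ^ c * N.factorial / poch c (N + 1)) =
        (N : ℂ) ^ (c - a) * (N : ℂ) ^ (c - b) * N.factorial * N.factorial /
          (poch (c - a - b) (N + 1) * poch c (N + 1)) := by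
      rw [← q1]; ring
    rw [q4]
    field_simp

/-- **Gauss's summation theorem**, for the regularized hypergeometric series. -/
theorem hasSum_gaussTerm {a b c : ℂ} (h : 0 < (c - a - b).re) :
    HasSum (gaussTerm a b c)
      (Complex.Gamma (c - a - b) * (Complex.Gamma (c - a))⁻¹ * (Complex.Gamma (c - b))⁻¹) := by
  -- Only `Re (c - a - b) > 0` is needed for convergence. The other three positivity conditions hold
  -- after shifting `c` by a large `n`, and the recurrence carries the formula back.
  suffices ∀ (n : ℕ) (c : ℂ), 0 < (c - a - b).re → 0 < (c + n).re → 0 < (c + n - a).re →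
      0 < (c + n - b).re → ∑' k, gaussTerm a b c k =
        Complex.Gamma (c - a - b) * (Complex.Gamma (c - a))⁻¹ * (Complex.Gamma (c - b))⁻¹ by
    obtain ⟨n, hn⟩ := exists_nat_gt (|c.re| + |a.re| + |b.re|)
    have e1 := neg_abs_le c.re
    have e2 := le_abs_self a.re
    have e3 := le_abs_self b.re
    have e4 := abs_nonneg a.re
    have e5 := abs_nonneg b.re
    rw [← this n c h (by simp; linarith) (by simp; linarith) (by simp; linarith)]
    exact (summable_norm_gaussTerm h).of_norm.hasSum
  intro n
  induction n with
  | zero =>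
    intro c h h1 h2 h3
    exact tsum_gaussTerm_of_re_pos (by simpa using h1) (by simpa using h2) (by simpa using h3) h
  | succ n ih =>
    intro c h h1 h2 h3
    have h' : 0 < (c + 1 - a - b).re := by simp at h ⊢; linarith
    have e : c + ((n + 1 : ℕ) : ℂ) = c + 1 + n := by push_cast; ring
    rw [e] at h1 h2 h3
    have i := ih (c + 1) h' h1 h2 h3
    have r := tsum_gaussTerm_recurrence h
    have hne : c - a - b ≠ 0 := by intro h0; simp [h0] at h
    rw [i, show c + 1 - a - b = c - a - b + 1 by ring, Gamma_add_one _ hne,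
      show c + 1 - a = c - a + 1 by ring, show c + 1 - b = c - b + 1 by ring] at r
    rw [inv_Gamma_eq_mul (c - a), inv_Gamma_eq_mul (c - b)]
    apply mul_left_cancel₀ hne
    rw [r]
    ring

/-! ### The double series and its inverse factorial sum. -/

/-- The numerators of the power series of the third Appell function along `(u, u / (u - 1))`,
as a double sequence. -/
noncomputable def appellTerm (α β α' δ : ℂ) (k : ℕ × ℕ) : ℂ :=
  poch α k.1 * poch β k.1 * poch α' k.2 * poch (δ + k.1) k.2 / (k.1.factorial * k.2.factorial)

/-- The diagonal sums of `appellTerm`. -/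
noncomputable def appellCoeff (α β α' δ : ℂ) (n : ℕ) : ℂ :=
  ∑ k ∈ Finset.HasAntidiagonal.antidiagonal n, appellTerm α β α' δ k

lemma exists_norm_appellTerm_le (α β α' δ : ℂ) :
    ∃ C : ℝ, 0 < C ∧ ∀ k : ℕ × ℕ, ‖appellTerm α β α' δ k‖ ≤
      C * ((k.1 : ℝ) + 1) ^ (α.re + β.re - δ.re - 1) * ((k.2 : ℝ) + 1) ^ (α'.re - 1) *
        pochSize δ.re (k.1 + k.2) := by
  obtain ⟨A, hA, ha⟩ := exists_norm_poch_le α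
  obtain ⟨B, hB, hb⟩ := exists_norm_poch_le β
  obtain ⟨A', hA', ha'⟩ := exists_norm_poch_le α'
  obtain ⟨D, hD, hd⟩ := exists_norm_poch_add_le δ
  refine ⟨A * B * A' * D, by positivity, fun ⟨k, l⟩ => ?_⟩
  have h1 := pochSize_pos α.re k
  have h2 := pochSize_pos β.re k
  have h3 := pochSize_pos α'.re l
  have h4 := pochSize_pos δ.re k
  have h5 := pochSize_pos δ.re (k + l)
  rw [appellTerm, norm_div, norm_mul, norm_mul, norm_mul, norm_mul, norm_natCast, norm_natCast]
  calc _ ≤ (A * pochSize α.re k) * (B * pochSize β.re k) * (A' * pochSize α'.re l) *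
        (D * (pochSize δ.re (k + l) / pochSize δ.re k)) / (k.factorial * l.factorial) := by
        gcongr
        · exact ha k
        · exact hb k
        · exact ha' l
        · exact hd k l
    _ = _ := by
        rw [show α.re + β.re - δ.re - 1 = (α.re - 1) + (β.re - 1) - (δ.re - 1) by ring,
          Real.rpow_sub (by positivity), Real.rpow_add (by positivity)]
        simp only [pochSize]
        have : (0 : ℝ) < k.factorial := by positivity
        have : (0 : ℝ) < l.factorial := by positivity
        field_simp

/-- The hypotheses are the three exponent conditions of `summable_rpow_mul_rpow_mul_rpow`: decay in
the second index, in the first, and in both jointly. -/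
lemma summable_norm_appellTerm_mul_inv_Gamma {α β α' δ s : ℂ} (h1 : 0 < (s - α' - δ).re)
    (h2 : 0 < (s - α - β).re) (h3 : 0 < (s - α' - α - β).re) :
    Summable fun k : ℕ × ℕ =>
      ‖appellTerm α β α' δ k * (Complex.Gamma (s + (k.1 + k.2 : ℕ)))⁻¹‖ := by
  obtain ⟨C, hC, hc⟩ := exists_norm_appellTerm_le α β α' δ
  obtain ⟨G, hG, hg⟩ := exists_norm_inv_Gamma_add_le s
  simp only [sub_re] at h1 h2 h3
  refine Summable.of_nonneg_of_le (fun _ => norm_nonneg _) (fun k => ?_)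
    ((summable_rpow_mul_rpow_mul_rpow (p := α.re + β.re - δ.re - 1) (q := α'.re - 1)
      (r := δ.re - s.re) (by linarith) (by linarith) (by linarith)).mul_left (C * G))
  have h5 := pochSize_pos δ.re (k.1 + k.2)
  have h6 := pochSize_pos s.re (k.1 + k.2)
  rw [norm_mul]
  calc _ ≤ C * ((k.1 : ℝ) + 1) ^ (α.re + β.re - δ.re - 1) * ((k.2 : ℝ) + 1) ^ (α'.re - 1) *
        pochSize δ.re (k.1 + k.2) * (G / pochSize s.re (k.1 + k.2)) := by
        gcongr
        · exact hc k
        · exact hg _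
    _ = _ := by
        rw [show δ.re - s.re = (δ.re - 1) - (s.re - 1) by ring,
          Real.rpow_sub (by positivity) (δ.re - 1) (s.re - 1)]
        simp only [pochSize, Nat.cast_add]
        have : (0 : ℝ) < (k.1 + k.2).factorial := by positivity
        have hv : 0 < ((k.1 : ℝ) + k.2 + 1) ^ (s.re - 1) := by positivity
        generalize ((k.1 : ℝ) + k.2 + 1) ^ (s.re - 1) = v at hv ⊢
        field_simp

lemma hasSum_antidiagonal {f : ℕ × ℕ → ℂ} {S : ℂ} (h : HasSum f S) :
    HasSum (fun n => ∑ k ∈ Finset.HasAntidiagonal.antidiagonal n, f k) S := by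
  have h' := (Finset.HasAntidiagonal.sigmaAntidiagonalEquivProd (A := ℕ)).hasSum_iff.2 h
  refine h'.sigma fun n => ?_
  have := hasSum_fintype (fun c : Finset.HasAntidiagonal.antidiagonal n => f c)
  rwa [Finset.sum_coe_sort (Finset.HasAntidiagonal.antidiagonal n) f] at this

lemma summable_norm_antidiagonal {f : ℕ × ℕ → ℂ} (h : Summable fun k => ‖f k‖) :
    Summable (fun n => ‖∑ k ∈ Finset.HasAntidiagonal.antidiagonal n, f k‖) := by
  have h' := ((Finset.HasAntidiagonal.sigmaAntidiagonalEquivProd (A := ℕ)).summable_iff.2 h).sigma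
  refine Summable.of_nonneg_of_le (fun _ => norm_nonneg _) (fun n => ?_) h'
  rw [tsum_fintype]
  refine (norm_sum_le _ _).trans (le_of_eq ?_)
  exact (Finset.sum_coe_sort (Finset.HasAntidiagonal.antidiagonal n) (fun k => ‖f k‖)).symm

lemma sum_appellTerm_mul_eq (α β α' δ : ℂ) (g : ℕ → ℂ) (n : ℕ) :
    ∑ k ∈ Finset.HasAntidiagonal.antidiagonal n, appellTerm α β α' δ k * g (k.1 + k.2) =
      appellCoeff α β α' δ n * g n := by
  rw [appellCoeff, Finset.sum_mul]
  refine Finset.sum_congr rfl fun k hk => ?_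
  rw [Finset.HasAntidiagonal.mem_antidiagonal.1 hk]

lemma summable_norm_appellCoeff_mul_inv_Gamma {α β α' δ s : ℂ} (h1 : 0 < (s - α' - δ).re)
    (h2 : 0 < (s - α - β).re) (h3 : 0 < (s - α' - α - β).re) :
    Summable fun n : ℕ => ‖appellCoeff α β α' δ n * (Complex.Gamma (s + n))⁻¹‖ := by
  have h := summable_norm_antidiagonal (summable_norm_appellTerm_mul_inv_Gamma h1 h2 h3)
  refine h.congr fun n => ?_
  rw [← sum_appellTerm_mul_eq α β α' δ (fun n => (Complex.Gamma (s + n))⁻¹)]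

lemma hasSum_appellCoeff_mul_inv_Gamma {α β α' δ s : ℂ} (h1 : 0 < (s - α' - δ).re)
    (h2 : 0 < (s - α - β).re) (h3 : 0 < (s - α' - α - β).re) :
    HasSum (fun n : ℕ => appellCoeff α β α' δ n * (Complex.Gamma (s + n))⁻¹)
      (Complex.Gamma (s - α' - δ) * Complex.Gamma (s - α' - α - β) *
        (Complex.Gamma (s - δ))⁻¹ * (Complex.Gamma (s - α' - α))⁻¹ *
          (Complex.Gamma (s - α' - β))⁻¹) := by
  have hs := (summable_norm_appellTerm_mul_inv_Gamma h1 h2 h3).of_norm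
  have inner : ∀ k : ℕ, HasSum (fun l : ℕ =>
      appellTerm α β α' δ (k, l) * (Complex.Gamma (s + (k + l : ℕ)))⁻¹)
      (poch α k * poch β k / k.factorial * (Complex.Gamma (s - α' - δ) *
        (Complex.Gamma (s - α' + k))⁻¹ * (Complex.Gamma (s - δ))⁻¹)) := by
    intro k
    -- Here `c - a - b = s - α' - δ` does not depend on `k`, so the sum over `l` leaves only `1 /
    -- Γ(s - α' + k)`, and the sum over `k` is again a Gauss series.
    have := hasSum_gaussTerm (a := α') (b := δ + k) (c := s + k)
      (by convert! h1 using 2; ring)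
    rw [show s + k - α' - (δ + k) = s - α' - δ by ring, show s + k - α' = s - α' + k by ring,
      show s + k - (δ + k) = s - δ by ring] at this
    refine (this.mul_left (poch α k * poch β k / k.factorial)).congr_fun ?_
    intro l
    rw [gaussTerm, appellTerm]
    push_cast
    rw [add_assoc s]
    have e1 : (k.factorial : ℂ) ≠ 0 := Nat.cast_ne_zero.2 k.factorial_ne_zero
    have e2 : (l.factorial : ℂ) ≠ 0 := Nat.cast_ne_zero.2 l.factorial_ne_zero
    field_simp
  have outer := hs.hasSum.prod_fiberwise inner
  have g := (hasSum_gaussTerm (a := α) (b := β) (c := s - α') h3).mul_left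
    (Complex.Gamma (s - α' - δ) * (Complex.Gamma (s - δ))⁻¹)
  have e := outer.unique (g.congr_fun (fun k => by rw [gaussTerm]; ring))
  have := hasSum_antidiagonal hs.hasSum
  simp only [sum_appellTerm_mul_eq α β α' δ (fun n => (Complex.Gamma (s + n))⁻¹)] at this
  rw [e] at this
  convert! this using 1
  ring

/-! ### Uniqueness of inverse factorial series. -/

lemma factorial_div_factorial_add_le {K k : ℕ} (h : K ≤ k) (n : ℕ) :
    (k.factorial : ℝ) / (k + n).factorial ≤ K.factorial / (K + n).factorial := by
  rw [div_le_div_iff₀ (by positivity) (by positivity)]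
  norm_cast
  induction n with
  | zero => simp [mul_comm]
  | succ n ih =>
    rw [← add_assoc, ← add_assoc, Nat.factorial_succ, Nat.factorial_succ]
    calc _ = (K + n + 1) * (k.factorial * (K + n).factorial) := by ring
      _ ≤ (k + n + 1) * (K.factorial * (k + n).factorial) := by gcongr
      _ = _ := by ring

/-- Multiply by `k!` and let `k → ∞`: only the term `n = 0` survives, because `k! / (k + n)! ≤ 1 /
(k + 1)` for `n ≥ 1`. These ratios decrease in `k`, so the series at `K` dominates. -/
lemma eq_zero_of_hasSum_div_factorial_zero {d : ℕ → ℂ} {K : ℕ}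
    (h : ∀ k, K ≤ k → HasSum (fun n => d n / (k + n).factorial) 0) : d 0 = 0 := by
  have e : ∀ k, K ≤ k → ∑' n, d n * ((k.factorial : ℂ) / (k + n).factorial) = 0 := by
    intro k hk
    have := ((h k hk).mul_left (k.factorial : ℂ)).tsum_eq
    rw [mul_zero] at this
    rw [← this]
    congr 1
    ext n
    ring
  have hs : Summable fun n => ‖d n‖ * ((K.factorial : ℝ) / (K + n).factorial) := by
    have := ((h K le_rfl).summable.norm).mul_left (K.factorial : ℝ)
    refine this.congr fun n => ?_
    rw [norm_div, norm_natCast]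
    ring
  have lim : Tendsto (fun k : ℕ => ∑' n, d n * ((k.factorial : ℂ) / (k + n).factorial)) atTop
      (𝓝 (∑' n, if n = 0 then d 0 else 0)) := by
    refine tendsto_tsum_of_dominated_convergence hs (fun n => ?_) ?_
    · rcases n with _ | n
      · simp only [add_zero, if_true]
        refine tendsto_const_nhds.congr fun k => ?_
        rw [div_self (Nat.cast_ne_zero.2 k.factorial_ne_zero), mul_one]
      · simp only [Nat.add_eq_zero_iff, one_ne_zero, and_false, if_false]
        have h0 : Tendsto (fun k : ℕ => ‖d (n + 1)‖ * (1 / ((k : ℝ) + 1))) atTop (𝓝 0) := by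
          simpa using (tendsto_one_div_add_atTop_nhds_zero_nat (𝕜 := ℝ)).const_mul ‖d (n + 1)‖
        refine squeeze_zero_norm (fun k => ?_) h0
        rw [norm_mul, norm_div, norm_natCast, norm_natCast]
        gcongr ?_ * ?_
        rw [div_le_div_iff₀ (by positivity) (by positivity), one_mul]
        norm_cast
        calc k.factorial * (k + 1) = (k + 1).factorial := by rw [Nat.factorial_succ, mul_comm]
          _ ≤ _ := Nat.factorial_le (by omega)
    · filter_upwards [eventually_ge_atTop K] with k hk n
      rw [norm_mul, norm_div, norm_natCast, norm_natCast]
      gcongr ?_ * ?_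
      exact factorial_div_factorial_add_le hk n
  rw [tsum_ite_eq] at lim
  refine tendsto_nhds_unique lim (tendsto_const_nhds.congr' ?_)
  filter_upwards [eventually_ge_atTop K] with k hk
  exact (e k hk).symm

lemma forall_eq_zero_of_hasSum_div_factorial_zero {d : ℕ → ℂ} {K : ℕ}
    (h : ∀ k, K ≤ k → HasSum (fun n => d n / (k + n).factorial) 0) (n : ℕ) : d n = 0 := by
  induction n generalizing d K with
  | zero => exact eq_zero_of_hasSum_div_factorial_zero h
  | succ n ih =>
    have h0 := eq_zero_of_hasSum_div_factorial_zero h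
    -- Dropping the vanishing first coefficient leaves a series of the same kind, with `k` raised by
    -- one.
    refine ih (d := fun n => d (n + 1)) (K := K + 1) fun k hk => ?_
    obtain ⟨k, rfl⟩ : ∃ j, k = j + 1 := ⟨k - 1, by omega⟩
    have := (hasSum_nat_add_iff' 1).2 (h k (by omega))
    simp only [Finset.range_one, Finset.sum_singleton, h0, zero_div, sub_zero] at this
    refine this.congr_fun fun j => ?_
    rw [show k + 1 + j = k + (j + 1) by ring]

/-- Inverse factorial series that agree at all large integers have the same coefficients. -/
lemma eq_of_hasSum_mul_inv_Gamma {d e : ℕ → ℂ} {f : ℂ → ℂ} {K : ℕ}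
    (hd : ∀ k : ℕ, K ≤ k → HasSum (fun n : ℕ => d n * (Complex.Gamma (k + n))⁻¹) (f k))
    (he : ∀ k : ℕ, K ≤ k → HasSum (fun n : ℕ => e n * (Complex.Gamma (k + n))⁻¹) (f k)) :
    d = e := by
  ext n
  refine sub_eq_zero.1 (forall_eq_zero_of_hasSum_div_factorial_zero (d := fun n => d n - e n)
    (K := K) (fun k hk => ?_) n)
  have := (hd (k + 1) (by omega)).sub (he (k + 1) (by omega))
  rw [sub_self] at this
  refine this.congr_fun fun j => ?_
  rw [show ((k + 1 : ℕ) : ℂ) + j = ((k + j : ℕ) : ℂ) + 1 by push_cast; ring, Gamma_nat_eq_factorial]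
  ring

/-! ### Permutation symmetry of the kernel coefficients. -/

/-- The coefficients of the kernel with Mellin transform
`Γ(σ) Γ(σ + a₁) Γ(σ + a₂) / (Γ(σ + b₁) Γ(σ + b₂) Γ(σ + b₃))`. -/
noncomputable def kernelCoeff (a₁ a₂ b₁ b₂ b₃ : ℂ) : ℕ → ℂ :=
  appellCoeff (b₂ - a₂) (b₃ - a₂) (b₁ - a₁) (b₂ + b₃ - a₁ - a₂)

/-- The value of the inverse factorial series with coefficients `kernelCoeff`. -/
noncomputable def kernelMellin (a₁ a₂ b₁ b₂ b₃ σ : ℂ) : ℂ :=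
  Complex.Gamma (σ + a₁) * Complex.Gamma (σ + a₂) * (Complex.Gamma (σ + b₁))⁻¹ *
    (Complex.Gamma (σ + b₂))⁻¹ * (Complex.Gamma (σ + b₃))⁻¹

section

variable {a₁ a₂ b₁ b₂ b₃ g σ : ℂ}

lemma summable_kernelCoeff_aux (hg : g = b₁ + b₂ + b₃ - a₁ - a₂) (h1 : 0 < (σ + a₁).re)
    (h2 : 0 < (σ + a₂).re) (h3 : 0 < (σ + a₂ - a₁ + b₁).re) :
    Summable fun n : ℕ => ‖kernelCoeff a₁ a₂ b₁ b₂ b₃ n * (Complex.Gamma (g + σ + n))⁻¹‖ := by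
  subst hg
  apply summable_norm_appellCoeff_mul_inv_Gamma
  · convert! h1 using 2; ring
  · convert! h3 using 2; ring
  · convert! h2 using 2; ring

lemma hasSum_kernelCoeff_aux (hg : g = b₁ + b₂ + b₃ - a₁ - a₂) (h1 : 0 < (σ + a₁).re)
    (h2 : 0 < (σ + a₂).re) (h3 : 0 < (σ + a₂ - a₁ + b₁).re) :
    HasSum (fun n : ℕ => kernelCoeff a₁ a₂ b₁ b₂ b₃ n * (Complex.Gamma (g + σ + n))⁻¹)
      (kernelMellin a₁ a₂ b₁ b₂ b₃ σ) := by
  subst hg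
  have e1 : b₁ + b₂ + b₃ - a₁ - a₂ + σ - (b₁ - a₁) - (b₂ + b₃ - a₁ - a₂) = σ + a₁ := by ring
  have e2 : b₁ + b₂ + b₃ - a₁ - a₂ + σ - (b₂ - a₂) - (b₃ - a₂) = σ + a₂ - a₁ + b₁ := by ring
  have e3 : b₁ + b₂ + b₃ - a₁ - a₂ + σ - (b₁ - a₁) - (b₂ - a₂) - (b₃ - a₂) = σ + a₂ := by ring
  have := hasSum_appellCoeff_mul_inv_Gamma (α := b₂ - a₂) (β := b₃ - a₂) (α' := b₁ - a₁)
    (δ := b₂ + b₃ - a₁ - a₂) (s := b₁ + b₂ + b₃ - a₁ - a₂ + σ)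
    (by rwa [e1]) (by rwa [e2]) (by rwa [e3])
  rw [e1, e3, show b₁ + b₂ + b₃ - a₁ - a₂ + σ - (b₂ + b₃ - a₁ - a₂) = σ + b₁ by ring,
    show b₁ + b₂ + b₃ - a₁ - a₂ + σ - (b₁ - a₁) - (b₂ - a₂) = σ + b₃ by ring,
    show b₁ + b₂ + b₃ - a₁ - a₂ + σ - (b₁ - a₁) - (b₃ - a₂) = σ + b₂ by ring] at this
  rw [kernelMellin]
  convert! this using 1
  ring

end

/-- At large integers `g + σ = k` all convergence conditions hold for both parameter sets, so
uniqueness applies. It is used for permutations, which visibly preserve `kernelMellin` but not the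
formula for `kernelCoeff`. -/
lemma kernelCoeff_eq_of_kernelMellin_eq {a₁ a₂ b₁ b₂ b₃ a₁' a₂' b₁' b₂' b₃' : ℂ}
    (hg : b₁ + b₂ + b₃ - a₁ - a₂ = b₁' + b₂' + b₃' - a₁' - a₂')
    (hM : ∀ σ, kernelMellin a₁ a₂ b₁ b₂ b₃ σ = kernelMellin a₁' a₂' b₁' b₂' b₃' σ) :
    kernelCoeff a₁ a₂ b₁ b₂ b₃ = kernelCoeff a₁' a₂' b₁' b₂' b₃' := by
  set g := b₁ + b₂ + b₃ - a₁ - a₂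
  obtain ⟨K, hK⟩ := exists_nat_gt (|(a₁ - g).re| + |(a₂ - g).re| + |(a₂ - a₁ + b₁ - g).re| +
    |(a₁' - g).re| + |(a₂' - g).re| + |(a₂' - a₁' + b₁' - g).re|)
  refine eq_of_hasSum_mul_inv_Gamma (K := K)
    (f := fun s => kernelMellin a₁ a₂ b₁ b₂ b₃ (s - g)) (fun k hk => ?_) (fun k hk => ?_)
  all_goals
    have hk' : (K : ℝ) ≤ k := Nat.cast_le.2 hk
    have c1 := neg_abs_le (a₁ - g).re
    have c2 := neg_abs_le (a₂ - g).re
    have c3 := neg_abs_le (a₂ - a₁ + b₁ - g).re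
    have c4 := neg_abs_le (a₁' - g).re
    have c5 := neg_abs_le (a₂' - g).re
    have c6 := neg_abs_le (a₂' - a₁' + b₁' - g).re
    have d1 := abs_nonneg (a₁ - g).re
    have d2 := abs_nonneg (a₂ - g).re
    have d3 := abs_nonneg (a₂ - a₁ + b₁ - g).re
    have d4 := abs_nonneg (a₁' - g).re
    have d5 := abs_nonneg (a₂' - g).re
    have d6 := abs_nonneg (a₂' - a₁' + b₁' - g).re
    have hk2 : (k : ℂ) = g + (k - g) := by ring
  · have := hasSum_kernelCoeff_aux (a₁ := a₁) (a₂ := a₂) (b₁ := b₁) (b₂ := b₂) (b₃ := b₃)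
      (g := g) (σ := k - g) rfl
      (by rw [show (k : ℂ) - g + a₁ = (k : ℂ) + (a₁ - g) by ring, add_re, natCast_re]; linarith)
      (by rw [show (k : ℂ) - g + a₂ = (k : ℂ) + (a₂ - g) by ring, add_re, natCast_re]; linarith)
      (by rw [show (k : ℂ) - g + a₂ - a₁ + b₁ = (k : ℂ) + (a₂ - a₁ + b₁ - g) by ring, add_re,
            natCast_re]; linarith)
    rwa [← hk2] at this
  · have := hasSum_kernelCoeff_aux (a₁ := a₁') (a₂ := a₂') (b₁ := b₁') (b₂ := b₂') (b₃ := b₃')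
      (g := g) (σ := k - g) hg
      (by rw [show (k : ℂ) - g + a₁' = (k : ℂ) + (a₁' - g) by ring, add_re, natCast_re]; linarith)
      (by rw [show (k : ℂ) - g + a₂' = (k : ℂ) + (a₂' - g) by ring, add_re, natCast_re]; linarith)
      (by rw [show (k : ℂ) - g + a₂' - a₁' + b₁' = (k : ℂ) + (a₂' - a₁' + b₁' - g) by ring, add_re,
            natCast_re]; linarith)
    rwa [← hk2, ← hM] at this

/-- Summability and value of the inverse factorial series with coefficients `kernelCoeff`. -/
lemma hasSum_kernelCoeff {a₁ a₂ b₁ b₂ b₃ g σ : ℂ} (hg : g = b₁ + b₂ + b₃ - a₁ - a₂)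
    (hg0 : 0 < g.re) (h0 : 0 < σ.re) (h1 : 0 < (σ + a₁).re) (h2 : 0 < (σ + a₂).re) :
    (Summable fun n : ℕ => ‖kernelCoeff a₁ a₂ b₁ b₂ b₃ n * (Complex.Gamma (g + σ + n))⁻¹‖) ∧
    HasSum (fun n : ℕ => kernelCoeff a₁ a₂ b₁ b₂ b₃ n * (Complex.Gamma (g + σ + n))⁻¹)
      (kernelMellin a₁ a₂ b₁ b₂ b₃ σ) := by
  wlog ha : a₁.re ≤ a₂.re generalizing a₁ a₂
  · have hM : ∀ σ, kernelMellin a₁ a₂ b₁ b₂ b₃ σ = kernelMellin a₂ a₁ b₁ b₂ b₃ σ := by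
      intro σ; simp only [kernelMellin]; ring
    rw [hM, kernelCoeff_eq_of_kernelMellin_eq (by ring) hM]
    exact this (by rw [hg]; ring) h2 h1 (not_le.1 ha).le
  wlog hb : b₂.re ≤ b₁.re generalizing b₁ b₂
  · have hM : ∀ σ, kernelMellin a₁ a₂ b₁ b₂ b₃ σ = kernelMellin a₁ a₂ b₂ b₁ b₃ σ := by
      intro σ; simp only [kernelMellin]; ring
    rw [hM, kernelCoeff_eq_of_kernelMellin_eq (by ring) hM]
    exact this (by rw [hg]; ring) (not_le.1 hb).le
  wlog hb' : b₃.re ≤ b₁.re generalizing b₁ b₃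
  · have hM : ∀ σ, kernelMellin a₁ a₂ b₁ b₂ b₃ σ = kernelMellin a₁ a₂ b₃ b₂ b₁ σ := by
      intro σ; simp only [kernelMellin]; ring
    rw [hM, kernelCoeff_eq_of_kernelMellin_eq (by ring) hM]
    have hb3 := (not_le.1 hb').le
    exact this (by rw [hg]; ring) (hb.trans hb3) hb3
  -- The extra convergence condition now follows from `Re g > 0` and the ordering: `a₂` has the
  -- larger real part of the `aᵢ`, and `b₁` the largest of the `bᵢ`.
  have h3 : 0 < (σ + a₂ - a₁ + b₁).re := by
    rw [hg] at hg0
    simp only [add_re, sub_re] at *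
    rcases le_total 0 b₁.re with hb0 | hb0
    · linarith
    · rcases le_total 0 a₂.re with h | h <;> linarith
  exact ⟨summable_kernelCoeff_aux hg h1 h2 h3, hasSum_kernelCoeff_aux hg h1 h2 h3⟩

/-! ### Convergence of the Appell series in the unit bidisc. -/

lemma summable_add_one_rpow_mul_geometric (p : ℝ) {x : ℝ} (h0 : 0 ≤ x) (h1 : x < 1) :
    Summable fun n : ℕ => ((n : ℝ) + 1) ^ p * x ^ n := by
  obtain ⟨y, hxy, hy1⟩ := exists_between h1
  have hy : 0 < y := h0.trans_lt hxy
  obtain ⟨m, hm⟩ := exists_nat_ge p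
  have h := ((summable_nat_add_iff 1).2 (summable_pow_mul_geometric_of_norm_lt_one (R := ℝ) m
    (r := y) (by rwa [Real.norm_of_nonneg hy.le]))).mul_right y⁻¹
  refine Summable.of_nonneg_of_le (fun _ => by positivity) (fun n => ?_) h
  rw [pow_succ, mul_assoc, mul_assoc, mul_inv_cancel₀ hy.ne', mul_one]
  push_cast
  gcongr
  rw [← Real.rpow_natCast]
  exact Real.rpow_le_rpow_of_exponent_le (by linarith [n.cast_nonneg (α := ℝ)]) hm

lemma summable_rpow_mul_geometric (p q r : ℝ) {x y : ℝ} (hx0 : 0 ≤ x) (hx1 : x < 1) (hy0 : 0 ≤ y)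
    (hy1 : y < 1) :
    Summable (fun k : ℕ × ℕ => ((k.1 : ℝ) + 1) ^ p * ((k.2 : ℝ) + 1) ^ q *
      ((k.1 : ℝ) + k.2 + 1) ^ r * (x ^ k.1 * y ^ k.2)) := by
  refine Summable.of_nonneg_of_le (fun _ => by positivity) (fun k => ?_)
    ((summable_add_one_rpow_mul_geometric (p + |r|) hx0 hx1).mul_of_nonneg
      (summable_add_one_rpow_mul_geometric (q + |r|) hy0 hy1)
      (fun _ => by positivity) (fun _ => by positivity))
  rw [Real.rpow_add (by positivity), Real.rpow_add (by positivity)]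
  have h1 : (1 : ℝ) ≤ (k.1 : ℝ) + k.2 + 1 := by
    have := k.1.cast_nonneg (α := ℝ); have := k.2.cast_nonneg (α := ℝ); linarith
  have h : ((k.1 : ℝ) + k.2 + 1) ^ r ≤ ((k.1 : ℝ) + 1) ^ |r| * ((k.2 : ℝ) + 1) ^ |r| := by
    rw [← Real.mul_rpow (by positivity) (by positivity)]
    calc _ ≤ ((k.1 : ℝ) + k.2 + 1) ^ |r| := Real.rpow_le_rpow_of_exponent_le h1 (le_abs_self r)
      _ ≤ _ := Real.rpow_le_rpow (by positivity)
        (by nlinarith [mul_nonneg (k.1.cast_nonneg (α := ℝ)) (k.2.cast_nonneg (α := ℝ))])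
        (abs_nonneg r)
  calc _ ≤ ((k.1 : ℝ) + 1) ^ p * ((k.2 : ℝ) + 1) ^ q *
        (((k.1 : ℝ) + 1) ^ |r| * ((k.2 : ℝ) + 1) ^ |r|) * (x ^ k.1 * y ^ k.2) := by gcongr
    _ = _ := by ring

lemma exists_norm_inv_poch_le {z : ℂ} (hz : 0 < z.re) :
    ∃ C : ℝ, 0 < C ∧ ∀ n : ℕ, ‖(poch z n)⁻¹‖ ≤ C / pochSize z.re n := by
  obtain ⟨C, hC, h⟩ := exists_le_norm_poch hz
  refine ⟨C, hC, fun n => ?_⟩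
  have hp := norm_pos_iff.2 (poch_ne_zero hz n)
  rw [norm_inv, inv_eq_one_div, div_le_div_iff₀ hp (pochSize_pos _ _), one_mul]
  exact (h n).2

lemma summable_norm_appellTerm_mul_geometric (α β α' δ : ℂ) {γ : ℂ} (hγ : 0 < γ.re) {x y : ℂ}
    (hx : ‖x‖ < 1) (hy : ‖y‖ < 1) :
    Summable fun k : ℕ × ℕ =>
      ‖appellTerm α β α' δ k / poch γ (k.1 + k.2) * (x ^ k.1 * y ^ k.2)‖ := by
  obtain ⟨C, hC, hc⟩ := exists_norm_appellTerm_le α β α' δ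
  obtain ⟨G, hG, hg⟩ := exists_norm_inv_poch_le hγ
  refine Summable.of_nonneg_of_le (fun _ => norm_nonneg _) (fun k => ?_)
    ((summable_rpow_mul_geometric (α.re + β.re - δ.re - 1) (α'.re - 1) (δ.re - γ.re)
      (norm_nonneg x) hx (norm_nonneg y) hy).mul_left (C * G))
  have h5 := pochSize_pos δ.re (k.1 + k.2)
  have h6 := pochSize_pos γ.re (k.1 + k.2)
  rw [norm_mul, div_eq_mul_inv, norm_mul, norm_mul, norm_pow, norm_pow]
  calc _ ≤ C * ((k.1 : ℝ) + 1) ^ (α.re + β.re - δ.re - 1) * ((k.2 : ℝ) + 1) ^ (α'.re - 1) *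
        pochSize δ.re (k.1 + k.2) * (G / pochSize γ.re (k.1 + k.2)) *
          (‖x‖ ^ k.1 * ‖y‖ ^ k.2) := by
        gcongr
        · exact hc k
        · exact hg _
    _ = _ := by
        rw [show δ.re - γ.re = (δ.re - 1) - (γ.re - 1) by ring,
          Real.rpow_sub (by positivity) (δ.re - 1) (γ.re - 1)]
        simp only [pochSize, Nat.cast_add]
        have : (0 : ℝ) < (k.1 + k.2).factorial := by positivity
        have hv : 0 < ((k.1 : ℝ) + k.2 + 1) ^ (γ.re - 1) := by positivity
        generalize ((k.1 : ℝ) + k.2 + 1) ^ (γ.re - 1) = v at hv ⊢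
        field_simp

lemma summable_appellF3Series (α α' β β' : ℂ) {γ : ℂ} (hγ : 0 < γ.re) {x y : ℂ}
    (hx : ‖x‖ < 1) (hy : ‖y‖ < 1) :
    Summable fun k : ℕ × ℕ => poch α k.1 * poch α' k.2 * poch β k.1 * poch β' k.2 /
      poch γ (k.1 + k.2) * (x ^ k.1 * y ^ k.2 / ((k.1.factorial : ℂ) * (k.2.factorial : ℂ))) := by
  obtain ⟨A, hA, ha⟩ := exists_norm_poch_le α
  obtain ⟨A', hA', ha'⟩ := exists_norm_poch_le α'
  obtain ⟨B, hB, hb⟩ := exists_norm_poch_le β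
  obtain ⟨B', hB', hb'⟩ := exists_norm_poch_le β'
  obtain ⟨G, hG, hg⟩ := exists_norm_inv_poch_le hγ
  apply Summable.of_norm
  refine Summable.of_nonneg_of_le (fun _ => norm_nonneg _) (fun ⟨k, l⟩ => ?_)
    ((summable_rpow_mul_geometric ((α.re - 1) + (β.re - 1)) ((α'.re - 1) + (β'.re - 1))
      (-(γ.re - 1)) (norm_nonneg x) hx (norm_nonneg y) hy).mul_left (A * A' * B * B' * G))
  have h1 := pochSize_pos α.re k
  have h2 := pochSize_pos β.re k
  have h3 := pochSize_pos α'.re l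
  have h4 := pochSize_pos β'.re l
  have h5 := pochSize_pos γ.re (k + l)
  have hfac : (k.factorial : ℝ) * l.factorial / (k + l).factorial ≤ 1 := by
    rw [div_le_one (by positivity)]
    exact_mod_cast Nat.le_of_dvd (Nat.factorial_pos _)
      (Nat.factorial_mul_factorial_dvd_factorial_add k l)
  rw [norm_mul, div_eq_mul_inv, norm_mul, norm_mul, norm_mul, norm_mul, norm_div, norm_mul, norm_mul,
    norm_pow, norm_pow, norm_natCast, norm_natCast]
  calc _ ≤ (A * pochSize α.re k) * (A' * pochSize α'.re l) * (B * pochSize β.re k) *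
        (B' * pochSize β'.re l) * (G / pochSize γ.re (k + l)) *
          (‖x‖ ^ k * ‖y‖ ^ l / (k.factorial * l.factorial)) := by
        gcongr
        · exact ha k
        · exact ha' l
        · exact hb k
        · exact hb' l
        · exact hg _
    _ = (k.factorial : ℝ) * l.factorial / (k + l).factorial * (A * A' * B * B' * G *
        (((k : ℝ) + 1) ^ ((α.re - 1) + (β.re - 1)) * ((l : ℝ) + 1) ^ ((α'.re - 1) + (β'.re - 1)) *
          ((k : ℝ) + l + 1) ^ (-(γ.re - 1)) * (‖x‖ ^ k * ‖y‖ ^ l))) := by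
        rw [Real.rpow_neg (by positivity), Real.rpow_add (by positivity),
          Real.rpow_add (by positivity)]
        simp only [pochSize, Nat.cast_add]
        have : (0 : ℝ) < k.factorial := by positivity
        have : (0 : ℝ) < l.factorial := by positivity
        have : (0 : ℝ) < (k + l).factorial := by positivity
        have hv : 0 < ((k : ℝ) + l + 1) ^ (γ.re - 1) := by positivity
        generalize ((k : ℝ) + l + 1) ^ (γ.re - 1) = v at hv ⊢
        field_simp
    _ ≤ _ := mul_le_of_le_one_left (by positivity) hfac

/-! ### Chu-Vandermonde and Pfaff's transformation. -/

lemma choose_add_sub_one (z : ℂ) (n : ℕ) : Ring.choose (z + n - 1) n = poch z n / n.factorial := by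
  have h := Ring.factorial_nsmul_multichoose_eq_ascPochhammer z n
  rw [Ring.multichoose_eq, Polynomial.ascPochhammer_smeval_eq_eval, nsmul_eq_mul] at h
  rw [eq_div_iff (Nat.cast_ne_zero.2 n.factorial_ne_zero), mul_comm, h, poch]

lemma choose_neg_eq_poch (z : ℂ) (n : ℕ) :
    Ring.choose (-z) n = (-1) ^ n * poch z n / n.factorial := by
  rw [Ring.choose_neg, choose_add_sub_one, Units.smul_def, zsmul_eq_mul]
  simp [mul_div_assoc]

/-- The Chu-Vandermonde identity. -/
lemma sum_antidiagonal_poch (c e : ℂ) (n : ℕ) :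
    ∑ k ∈ Finset.HasAntidiagonal.antidiagonal n, (-1) ^ k.1 * poch e k.1 / k.1.factorial *
      (poch (c + k.1) k.2 / k.2.factorial) = poch (c - e) n / n.factorial := by
  have h := Ring.add_choose_eq (r := -e) (s := c + n - 1) n (Commute.all _ _)
  rw [show -e + (c + n - 1) = (c - e) + n - 1 by ring, choose_add_sub_one] at h
  rw [h]
  refine Finset.sum_congr rfl fun k hk => ?_
  have hk' : k.1 + k.2 = n := Finset.HasAntidiagonal.mem_antidiagonal.1 hk
  rw [choose_neg_eq_poch, ← hk', Nat.cast_add, show c + ((k.1 : ℂ) + k.2) - 1 = (c + k.1) + k.2 - 1 by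
    ring, choose_add_sub_one]

lemma hasSum_poch_mul_pow (a : ℂ) {y : ℂ} (hy : ‖y‖ < 1) :
    HasSum (fun n : ℕ => poch a n / n.factorial * y ^ n) ((1 - y) ^ (-a)) := by
  have h := (one_div_one_sub_cpow_hasFPowerSeriesOnBall_zero a).hasSum (y := y)
    (by rw [← ENNReal.ofReal_one, Metric.eball_ofReal]; simpa using hy)
  simp only [zero_add, choose_add_sub_one] at h
  rw [cpow_neg, ← one_div]
  refine h.congr_fun fun n => ?_
  simp [mul_comm]

/-- Pfaff's transformation near the origin. -/
lemma pfaff_transformation (a b : ℂ) {c : ℂ} (hc : 0 < c.re) {y : ℂ} (hy : ‖y‖ < 1 / 2) :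
    ∑' n : ℕ, poch a n * poch b n / (poch c n * n.factorial) * y ^ n =
      (1 - y) ^ (-a) * ∑' n : ℕ,
        poch a n * poch (c - b) n / (poch c n * n.factorial) * (y / (y - 1)) ^ n := by
  have hy1 : ‖y‖ < 1 := by linarith
  have hy0 : 1 - y ≠ 0 := by
    intro h
    rw [← sub_eq_zero.1 h, norm_one] at hy1
    exact lt_irrefl _ hy1
  -- The right-hand side with `(1 - y) ^ (-a - k)` expanded by the binomial series: row sums give
  -- that side, diagonal sums the left one.
  let D : ℕ × ℕ → ℂ := fun k => poch a k.1 * poch (c - b) k.1 / (poch c k.1 * k.1.factorial) *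
    ((-1) ^ k.1 * y ^ k.1) * (poch (a + k.1) k.2 / k.2.factorial * y ^ k.2)
  have hD : Summable D := by
    obtain ⟨A, hA, ha⟩ := exists_norm_poch_le a
    obtain ⟨B, hB, hb⟩ := exists_norm_poch_le (c - b)
    obtain ⟨G, hG, hg⟩ := exists_norm_inv_poch_le hc
    -- The factor `2` absorbs the binomial coefficient `(k + l)! / (k! l!) ≤ 2 ^ (k + l)`; this is
    -- why the radius is `1 / 2`.
    have h2 : 2 * ‖y‖ < 1 := by linarith
    apply Summable.of_norm
    refine Summable.of_nonneg_of_le (fun _ => norm_nonneg _) (fun ⟨k, l⟩ => ?_)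
      ((summable_rpow_mul_geometric (((c - b).re - 1) - (c.re - 1)) 0 (a.re - 1)
        (by positivity) h2 (by positivity) h2).mul_left (A * B * G))
    have h1 := pochSize_pos a.re (k + l)
    have h2 := pochSize_pos (c - b).re k
    have h3 := pochSize_pos c.re k
    have hfac : ((k + l).factorial : ℝ) / (k.factorial * l.factorial) ≤ 2 ^ k * 2 ^ l := by
      rw [div_le_iff₀ (by positivity), ← pow_add]
      have h4 := Nat.add_choose_mul_factorial_mul_factorial k l
      have h5 := Nat.choose_le_two_pow (k + l) l
      rw [← h4]
      push_cast
      rw [mul_assoc]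
      gcongr
      exact_mod_cast h5
    have e : D (k, l) = poch a (k + l) * poch (c - b) k * (poch c k)⁻¹ * ((-1) ^ k * y ^ k * y ^ l) /
        (k.factorial * l.factorial) := by
      simp only [D, poch_add]
      ring
    rw [e]
    simp only [norm_div, norm_mul, norm_pow, norm_neg, norm_one, one_pow, one_mul, Complex.norm_natCast]
    calc _ ≤ (A * pochSize a.re (k + l)) * (B * pochSize (c - b).re k) * (G / pochSize c.re k) *
          (‖y‖ ^ k * ‖y‖ ^ l) / (k.factorial * l.factorial) := by
          gcongr
          · exact ha _
          · exact hb k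
          · exact hg k
      _ = ((k + l).factorial : ℝ) / (k.factorial * l.factorial) * (A * B * G *
          (((k : ℝ) + 1) ^ (((c - b).re - 1) - (c.re - 1)) * ((l : ℝ) + 1) ^ (0 : ℝ) *
            ((k : ℝ) + l + 1) ^ (a.re - 1) * (‖y‖ ^ k * ‖y‖ ^ l))) := by
          rw [Real.rpow_zero, Real.rpow_sub (by positivity) ((c - b).re - 1) (c.re - 1)]
          simp only [pochSize, Nat.cast_add]
          have : (0 : ℝ) < k.factorial := by positivity
          have : (0 : ℝ) < l.factorial := by positivity
          have hv : 0 < ((k : ℝ) + 1) ^ (c.re - 1) := by positivity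
          generalize ((k : ℝ) + 1) ^ (c.re - 1) = v at hv ⊢
          field_simp
      _ ≤ (2 ^ k * 2 ^ l) * (A * B * G *
          (((k : ℝ) + 1) ^ (((c - b).re - 1) - (c.re - 1)) * ((l : ℝ) + 1) ^ (0 : ℝ) *
            ((k : ℝ) + l + 1) ^ (a.re - 1) * (‖y‖ ^ k * ‖y‖ ^ l))) := by gcongr
      _ = _ := by rw [mul_pow, mul_pow]; ring
  have inner : ∀ k : ℕ, HasSum (fun l => D (k, l)) ((1 - y) ^ (-a) *
      (poch a k * poch (c - b) k / (poch c k * k.factorial) * (y / (y - 1)) ^ k)) := by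
    intro k
    have h := (hasSum_poch_mul_pow (a + k) hy1).mul_left
      (poch a k * poch (c - b) k / (poch c k * k.factorial) * ((-1) ^ k * y ^ k))
    convert! h using 1
    rw [neg_add, cpow_add _ _ hy0, cpow_neg _ (k : ℂ), cpow_natCast,
      show y - 1 = (-1) * (1 - y) by ring, div_pow, mul_pow]
    have : ((-1 : ℂ) ^ k) * (-1) ^ k = 1 := by rw [← mul_pow]; simp
    have h3 : ((-1 : ℂ) ^ k)⁻¹ = (-1) ^ k := inv_eq_of_mul_eq_one_left this
    rw [div_eq_mul_inv (y ^ k), mul_inv, h3]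
    ring
  have h1 := (hD.hasSum.prod_fiberwise inner).tsum_eq
  have h2 := (hasSum_antidiagonal hD.hasSum).tsum_eq
  rw [← tsum_mul_left, h1, ← h2]
  congr 1
  ext n
  have key := sum_antidiagonal_poch c (c - b) n
  rw [sub_sub_cancel] at key
  have hn := poch_ne_zero hc n
  calc _ = poch a n / poch c n * y ^ n * (poch b n / n.factorial) := by
        have : (n.factorial : ℂ) ≠ 0 := Nat.cast_ne_zero.2 n.factorial_ne_zero
        field_simp
    _ = _ := by
        rw [← key, Finset.mul_sum]
        refine Finset.sum_congr rfl fun k hk => ?_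
        have hk' : k.1 + k.2 = n := Finset.HasAntidiagonal.mem_antidiagonal.1 hk
        subst hk'
        rw [poch_add] at hn ⊢
        have := left_ne_zero_of_mul hn
        have := right_ne_zero_of_mul hn
        simp only [D]
        rw [poch_add, pow_add]
        field_simp

/-! ### Analytic continuation of the third Appell function. -/

lemma differentiableOn_appellTerm_tsum (α β α' δ : ℂ) {γ : ℂ} (hγ : 0 < γ.re) {x : ℂ}
    (hx : ‖x‖ < 1) :
    DifferentiableOn ℂ (fun w => ∑' k : ℕ × ℕ,
      appellTerm α β α' δ k / poch γ (k.1 + k.2) * (x ^ k.1 * w ^ k.2)) (Metric.ball 0 1) := by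
  intro w hw
  rw [mem_ball_zero_iff] at hw
  obtain ⟨r, hwr, hr⟩ := exists_between hw
  have hr0 : 0 ≤ r := (norm_nonneg w).trans hwr.le
  have hs := summable_norm_appellTerm_mul_geometric α β α' δ hγ (y := (r : ℂ)) hx
    (by rwa [norm_real, Real.norm_of_nonneg hr0])
  have hd := differentiableOn_tsum_of_summable_norm (U := Metric.ball (0 : ℂ) r)
    (F := fun (k : ℕ × ℕ) w => appellTerm α β α' δ k / poch γ (k.1 + k.2) * (x ^ k.1 * w ^ k.2)) hs
    (fun k => by fun_prop) Metric.isOpen_ball (fun k z hz => ?_)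
  · exact (hd.differentiableAt (Metric.isOpen_ball.mem_nhds
      (mem_ball_zero_iff.2 hwr))).differentiableWithinAt
  · rw [mem_ball_zero_iff] at hz
    simp only [norm_mul, norm_pow, norm_real, Real.norm_of_nonneg hr0]
    gcongr

lemma norm_div_sub_one_lt_one {y : ℂ} (hy : y.re < 1 / 2) : ‖y / (y - 1)‖ < 1 := by
  have h0 : y - 1 ≠ 0 := by
    intro h
    rw [sub_eq_zero.1 h] at hy
    norm_num at hy
  rw [norm_div, div_lt_one (norm_pos_iff.2 h0), norm_def, norm_def]
  apply Real.sqrt_lt_sqrt (normSq_nonneg _)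
  simp only [normSq_apply, sub_re, one_re, sub_im, one_im, sub_zero]
  nlinarith

/-- The double series of the third Appell function, rearranged by Pfaff's transformation. -/
lemma appellF3Series_eq (α α' β β' : ℂ) {γ : ℂ} (hγ : 0 < γ.re) {x y : ℂ} (hx : ‖x‖ < 1)
    (hy : ‖y‖ < 1 / 2) :
    appellF3Series α α' β β' γ x y = (1 - y) ^ (-α') * ∑' k : ℕ × ℕ,
      appellTerm α β α' (γ - β') k / poch γ (k.1 + k.2) * (x ^ k.1 * (y / (y - 1)) ^ k.2) := by
  have s1 := summable_appellF3Series α α' β β' hγ hx (y := y) (by linarith)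
  have hre : y.re < 1 / 2 := (re_le_norm y).trans_lt hy
  have s2 := (summable_norm_appellTerm_mul_geometric α β α' (γ - β') hγ hx
    (norm_div_sub_one_lt_one hre)).of_norm
  change ∑' k : ℕ × ℕ, poch α k.1 * poch α' k.2 * poch β k.1 * poch β' k.2 /
      poch γ (k.1 + k.2) * (x ^ k.1 * y ^ k.2 / ((k.1.factorial : ℂ) * (k.2.factorial : ℂ))) = _
  rw [s1.tsum_prod, s2.tsum_prod, ← tsum_mul_left]
  congr 1
  ext k
  have hk : 0 < (γ + k).re := by simp; positivity
  -- For fixed `k`, the inner sum is a Gauss series in `y` with lower parameter `γ + k`.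
  have p := pfaff_transformation α' β' hk hy
  have e1 : ∀ l : ℕ, poch α k * poch α' l * poch β k * poch β' l / poch γ (k + l) *
      (x ^ k * y ^ l / ((k.factorial : ℂ) * (l.factorial : ℂ))) =
      poch α k * poch β k * x ^ k / (poch γ k * k.factorial) *
        (poch α' l * poch β' l / (poch (γ + k) l * l.factorial) * y ^ l) := by
    intro l
    rw [poch_add]
    ring
  have e2 : ∀ l : ℕ, appellTerm α β α' (γ - β') (k, l) / poch γ (k + l) *
      (x ^ k * (y / (y - 1)) ^ l) =
      poch α k * poch β k * x ^ k / (poch γ k * k.factorial) *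
        (poch α' l * poch (γ + k - β') l / (poch (γ + k) l * l.factorial) *
          (y / (y - 1)) ^ l) := by
    intro l
    rw [poch_add, appellTerm, show γ - β' + k = γ + k - β' by ring]
    ring
  simp only [e1, e2]
  rw [tsum_mul_left, tsum_mul_left, p]
  ring

/-- The Pfaff-transformed series converges wherever `|y / (y - 1)| < 1`, that is on the half-plane
`Re y < 1 / 2`. This is star-shaped about `0` and contains the negative axis, where the kernel is
evaluated. -/
lemma hasStarContinuation_appellF3Series (α α' β β' : ℂ) {γ : ℂ} (hγ : 0 < γ.re) {x y : ℂ}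
    (hx : ‖x‖ < 1) (hy : y.re < 1 / 2) :
    HasStarContinuation (fun z => appellF3Series α α' β β' γ x z) y
      ((1 - y) ^ (-α') * ∑' k : ℕ × ℕ, appellTerm α β α' (γ - β') k / poch γ (k.1 + k.2) *
        (x ^ k.1 * (y / (y - 1)) ^ k.2)) := by
  have hU : IsOpen {z : ℂ | z.re < 1 / 2} := isOpen_lt continuous_re continuous_const
  refine ⟨{z | z.re < 1 / 2}, fun y => (1 - y) ^ (-α') * ∑' k : ℕ × ℕ,
    appellTerm α β α' (γ - β') k / poch γ (k.1 + k.2) * (x ^ k.1 * (y / (y - 1)) ^ k.2),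
    hU, ?_, hy, ?_, ?_, rfl⟩
  · exact (convex_halfSpace_re_lt (1 / 2)).starConvex (by simp)
  · refine DifferentiableOn.mul ?_ ?_
    · refine DifferentiableOn.cpow_const (by fun_prop) fun z hz => ?_
      left
      simp only [Set.mem_ofPred_eq] at hz
      simp only [sub_re, one_re]
      linarith
    · refine (differentiableOn_appellTerm_tsum α β α' (γ - β') hγ hx).comp
        (t := Metric.ball 0 1) (f := fun y : ℂ => y / (y - 1)) ?_ ?_
      · refine DifferentiableOn.div (by fun_prop) (by fun_prop) fun z hz h => ?_
        simp only [Set.mem_ofPred_eq, sub_eq_zero.1 h] at hz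
        norm_num at hz
      · intro z hz
        exact mem_ball_zero_iff.2 (norm_div_sub_one_lt_one hz)
  · filter_upwards [Metric.ball_mem_nhds (0 : ℂ) (ε := 1 / 2) (by norm_num)] with z hz
    exact (appellF3Series_eq α α' β β' hγ hx (mem_ball_zero_iff.1 hz)).symm

lemma HasStarContinuation.starContinuation_eq {f : ℂ → ℂ} {y w : ℂ}
    (h : HasStarContinuation f y w) : starContinuation f y = w := by
  have h' : ∃ w, HasStarContinuation f y w := ⟨w, h⟩
  rw [starContinuation, dif_pos h']
  exact h'.choose_spec.unique h

/-- The third Appell function in the kernel of the fractional integral. -/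
lemma appellF3_kernel (α α' β β' : ℂ) {γ : ℂ} (hγ : 0 < γ.re) {x t : ℝ} (ht : 0 < t)
    (htx : t < x) :
    HasSum (fun n : ℕ => appellCoeff α β α' (γ - β') n / poch γ n * (1 - (t : ℂ) / x) ^ n)
      (((t : ℂ) / x) ^ (-α') * appellF3 α α' β β' γ (1 - (t : ℂ) / x) (1 - (x : ℂ) / t)) := by
  have hx : 0 < x := ht.trans htx
  have ht' : (t : ℂ) ≠ 0 := by exact_mod_cast ht.ne'
  have hx' : (x : ℂ) ≠ 0 := by exact_mod_cast hx.ne'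
  have hu : ‖1 - (t : ℂ) / x‖ < 1 := by
    rw [show 1 - (t : ℂ) / x = ((1 - t / x : ℝ) : ℂ) by push_cast; rfl, norm_real, Real.norm_eq_abs,
      abs_lt]
    have : 0 < t / x := by positivity
    have : t / x < 1 := (div_lt_one hx).2 htx
    constructor <;> linarith
  have hy : (1 - (x : ℂ) / t).re < 1 / 2 := by
    rw [show 1 - (x : ℂ) / t = ((1 - x / t : ℝ) : ℂ) by push_cast; rfl, ofReal_re]
    have : 1 < x / t := (one_lt_div ht).2 htx
    linarith
  have hw : (1 - (x : ℂ) / t) / (1 - (x : ℂ) / t - 1) = 1 - (t : ℂ) / x := by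
    have : 1 - (x : ℂ) / t - 1 ≠ 0 := by
      rw [sub_sub_cancel_left]; exact neg_ne_zero.2 (div_ne_zero hx' ht')
    rw [div_eq_iff this]
    field_simp
    ring
  have hF : appellF3 α α' β β' γ (1 - (t : ℂ) / x) (1 - (x : ℂ) / t) = _ :=
    (hasStarContinuation_appellF3Series α α' β β' hγ hu hy).starContinuation_eq
  have hs := (summable_norm_appellTerm_mul_geometric α β α' (γ - β') hγ hu hu).of_norm.hasSum
  rw [hF, hw]
  have hpow : ((t : ℂ) / x) ^ (-α') * (1 - (1 - (x : ℂ) / t)) ^ (-α') = 1 := by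
    rw [sub_sub_cancel, ← ofReal_div, ← ofReal_div,
      ← mul_cpow_ofReal_nonneg (by positivity) (by positivity), ← ofReal_mul,
      show t / x * (x / t) = 1 by field_simp]
    simp
  rw [← mul_assoc, hpow, one_mul]
  have := hasSum_antidiagonal hs
  refine this.congr_fun fun n => ?_
  rw [appellCoeff, Finset.sum_div, Finset.sum_mul]
  refine Finset.sum_congr rfl fun k hk => ?_
  rw [← Finset.HasAntidiagonal.mem_antidiagonal.1 hk, pow_add]

/-! ### Beta integrals and the action on powers. -/

lemma norm_cpow_mul_cpow_eq {x t : ℝ} (ht : 0 < t) (htx : t < x) (u v : ℂ) :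
    ((‖(t : ℂ) ^ u * ((x : ℂ) - t) ^ v‖ : ℝ) : ℂ) =
      (t : ℂ) ^ (u.re : ℂ) * ((x : ℂ) - t) ^ (v.re : ℂ) := by
  have h : 0 < x - t := sub_pos.2 htx
  rw [← ofReal_sub, norm_mul, norm_cpow_eq_rpow_re_of_pos ht, norm_cpow_eq_rpow_re_of_pos h,
    ofReal_mul, ofReal_cpow ht.le, ofReal_cpow h.le]

lemma integrableOn_beta {x : ℝ} (hx : 0 < x) {u v : ℂ} (hu : 0 < u.re) (hv : 0 < v.re) :
    IntegrableOn (fun t : ℝ => (t : ℂ) ^ (u - 1) * ((x : ℂ) - t) ^ (v - 1)) (Set.Ioo 0 x) := by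
  have h := (betaIntegral_convergent hu hv).comp_mul_left (c := x⁻¹)
  rw [zero_div, one_div, inv_inv, intervalIntegrable_iff_integrableOn_Ioo_of_le hx.le] at h
  refine IntegrableOn.congr_fun (h.const_mul ((x : ℂ) ^ (u - 1) * (x : ℂ) ^ (v - 1)))
    (fun t ht => ?_) measurableSet_Ioo
  have hx' : (x : ℂ) ≠ 0 := ofReal_ne_zero.2 hx.ne'
  have h1 : 0 ≤ x⁻¹ * t := by have := ht.1; positivity
  have h2 : 0 ≤ 1 - x⁻¹ * t := by
    rw [sub_nonneg, inv_mul_le_iff₀ hx, mul_one]; exact ht.2.le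
  rw [mul_mul_mul_comm, ← mul_cpow_ofReal_nonneg hx.le h1]
  rw [show (1 : ℂ) - ((x⁻¹ * t : ℝ) : ℂ) = ((1 - x⁻¹ * t : ℝ) : ℂ) by push_cast; rfl,
    ← mul_cpow_ofReal_nonneg hx.le h2]
  push_cast
  rw [mul_sub, ← mul_assoc, mul_inv_cancel₀ hx', one_mul, mul_one]

lemma setIntegral_beta {x : ℝ} (hx : 0 < x) {u v : ℂ} (hu : 0 < u.re) (hv : 0 < v.re) :
    ∫ t in Set.Ioo 0 x, (t : ℂ) ^ (u - 1) * ((x : ℂ) - t) ^ (v - 1) =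
      (x : ℂ) ^ (u + v - 1) * (Complex.Gamma u * Complex.Gamma v * (Complex.Gamma (u + v))⁻¹) := by
  rw [← integral_Ioc_eq_integral_Ioo, ← intervalIntegral.integral_of_le hx.le,
    betaIntegral_scaled _ _ hx, betaIntegral_eq_Gamma_mul_div _ _ hu hv, div_eq_mul_inv]

/-- The norm of the integrand is the beta integrand with `u` and `v` replaced by their real parts.
-/
lemma integral_norm_beta {x : ℝ} (hx : 0 < x) {u v : ℂ} (hu : 0 < u.re) (hv : 0 < v.re) :
    ∫ t in Set.Ioo 0 x, ‖(t : ℂ) ^ (u - 1) * ((x : ℂ) - t) ^ (v - 1)‖ =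
      x ^ (u.re + v.re - 1) * ‖Complex.Gamma u.re * Complex.Gamma v.re *
        (Complex.Gamma ((u.re : ℂ) + v.re))⁻¹‖ := by
  have h := setIntegral_beta hx (u := u.re) (v := v.re) (by simpa using hu) (by simpa using hv)
  have e : ∫ t in Set.Ioo 0 x, (t : ℂ) ^ ((u.re : ℂ) - 1) * ((x : ℂ) - t) ^ ((v.re : ℂ) - 1) =
      ((∫ t in Set.Ioo 0 x, ‖(t : ℂ) ^ (u - 1) * ((x : ℂ) - t) ^ (v - 1)‖ : ℝ) : ℂ) := by
    rw [← integral_complex_ofReal]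
    refine setIntegral_congr_fun measurableSet_Ioo fun t ht => ?_
    rw [norm_cpow_mul_cpow_eq ht.1 ht.2]
    simp
  rw [e] at h
  have h' := congrArg norm h
  rw [norm_real, Real.norm_of_nonneg (integral_nonneg fun _ => norm_nonneg _), norm_mul,
    norm_cpow_eq_rpow_re_of_pos hx] at h'
  rw [h']
  simp

lemma norm_poch_re_le (z : ℂ) (n : ℕ) : ‖poch z.re n‖ ≤ ‖poch z n‖ := by
  rw [poch_eq_prod, poch_eq_prod, norm_prod, norm_prod]
  refine Finset.prod_le_prod (fun _ _ => norm_nonneg _) fun j _ => ?_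
  rw [← ofReal_natCast, ← ofReal_add, norm_real]
  exact (abs_re_le_norm (z + (j : ℝ))).trans' (by simp)

lemma integrable_of_hasSum_of_summable_integral_norm {X : Type*} [MeasurableSpace X]
    {ν : Measure X} {F : ℕ → X → ℂ} {f : X → ℂ} (hF : ∀ n, Integrable (F n) ν)
    (hs : Summable fun n => ∫ t, ‖F n t‖ ∂ν) (hf : ∀ᵐ t ∂ν, HasSum (fun n => F n t) (f t)) :
    Integrable f ν ∧ HasSum (fun n => ∫ t, F n t ∂ν) (∫ t, f t ∂ν) := by
  have e : (fun t => ∑' n, F n t) =ᵐ[ν] f := hf.mono fun t ht => ht.tsum_eq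
  have h := hasSum_integral_of_summable_integral_norm hF hs
  rw [integral_congr_ae e] at h
  refine ⟨⟨?_, ?_⟩, h⟩
  · refine aestronglyMeasurable_of_tendsto_ae atTop
      (f := fun N t => ∑ n ∈ Finset.range N, F n t) (fun N => ?_)
      (hf.mono fun t ht => ht.tendsto_sum_nat)
    exact (integrable_finsetSum _ fun n _ => hF n).aestronglyMeasurable
  · have h1 : ∀ n, ∫⁻ t, ‖F n t‖ₑ ∂ν = ENNReal.ofReal (∫ t, ‖F n t‖ ∂ν) := fun n =>
      (ofReal_integral_norm_eq_lintegral_enorm (hF n)).symm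
    calc ∫⁻ t, ‖f t‖ₑ ∂ν ≤ ∫⁻ t, ∑' n, ‖F n t‖ₑ ∂ν := by
          refine lintegral_mono_ae (hf.mono fun t ht => ?_)
          rw [← ht.tsum_eq]
          exact enorm_tsum_le_tsum_enorm
      _ = ∑' n, ∫⁻ t, ‖F n t‖ₑ ∂ν := lintegral_tsum fun n => (hF n).1.enorm
      _ = ENNReal.ofReal (∑' n, ∫ t, ‖F n t‖ ∂ν) := by
          simp only [h1]
          exact (ENNReal.ofReal_tsum_of_nonneg
            (fun n => integral_nonneg fun _ => norm_nonneg _) hs).symm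
      _ < ⊤ := ENNReal.ofReal_lt_top

/-- The Mellin transform of the kernel of the fractional integral: the action of the
Marichev-Saigo-Maeda integral on powers. -/
lemma integrableOn_msm_cpow (α α' β β' : ℂ) {γ σ : ℂ} (hγ : 0 < γ.re) (h0 : 0 < σ.re)
    (h1 : (α' - β').re < σ.re) (h2 : (α + α' + β - γ).re < σ.re) {x : ℝ} (hx : 0 < x) :
    IntegrableOn (fun t : ℝ => ((x - t : ℝ) : ℂ) ^ (γ - 1) * (t : ℂ) ^ (-α') *
      appellF3 α α' β β' γ (1 - (t : ℂ) / x) (1 - (x : ℂ) / t) * (t : ℂ) ^ (σ - 1))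
        (Set.Ioo 0 x) ∧
    ∫ t in Set.Ioo 0 x, ((x - t : ℝ) : ℂ) ^ (γ - 1) * (t : ℂ) ^ (-α') *
      appellF3 α α' β β' γ (1 - (t : ℂ) / x) (1 - (x : ℂ) / t) * (t : ℂ) ^ (σ - 1) =
        (x : ℂ) ^ (σ + γ - α' - 1) * (Complex.Gamma γ * (Complex.Gamma σ * kernelMellin
          (β' - α') (γ - α - α' - β) β' (γ - α' - β) (γ - α - α') σ)) := by
  have hx' : (x : ℂ) ≠ 0 := ofReal_ne_zero.2 hx.ne'
  set c : ℕ → ℂ := kernelCoeff (β' - α') (γ - α - α' - β) β' (γ - α' - β) (γ - α - α') with hc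
  have hcoeff : appellCoeff α β α' (γ - β') = c := by
    rw [hc, kernelCoeff]
    congr 1 <;> ring
  have hsum : γ = β' + (γ - α' - β) + (γ - α - α') - (β' - α') - (γ - α - α' - β) := by ring
  simp only [sub_re, add_re] at h1 h2
  have hS := hasSum_kernelCoeff (σ := σ) hsum hγ h0 (by simp; linarith) (by simp; linarith)
  -- With this argument the Gamma factors become those of `Re γ + Re σ + n`, as in the integrals of
  -- the norms. Its absolute convergence is what termwise integration requires.
  have hS' := hasSum_kernelCoeff (σ := ((γ.re + σ.re : ℝ) : ℂ) - γ) hsum hγ (by simpa using h0)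
    (by simp; linarith) (by simp; linarith)
  rw [← hc] at hS hS'
  have hγn : ∀ n : ℕ, 0 < (γ + n).re := fun n => by simp; positivity
  let F : ℕ → ℝ → ℂ := fun n t => c n / poch γ n * ((x : ℂ) ^ (-α') * ((x : ℂ) ^ n)⁻¹) *
    ((t : ℂ) ^ (σ - 1) * ((x : ℂ) - t) ^ (γ + n - 1))
  have hF : ∀ n, IntegrableOn (F n) (Set.Ioo 0 x) := fun n =>
    (integrableOn_beta hx h0 (hγn n)).const_mul _
  have hnorm : Summable fun n => ∫ t in Set.Ioo 0 x, ‖F n t‖ := by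
    refine Summable.of_nonneg_of_le (fun n => integral_nonneg fun _ => norm_nonneg _) (fun n => ?_)
      (hS'.1.mul_left (x ^ (-α'.re) * x ^ (σ.re + γ.re - 1) *
        ‖Complex.Gamma σ.re * Complex.Gamma γ.re‖))
    simp only [F, norm_mul (c n / poch γ n * ((x : ℂ) ^ (-α') * ((x : ℂ) ^ n)⁻¹))]
    rw [integral_const_mul, integral_norm_beta hx h0 (hγn n)]
    have hp := norm_pos_iff.2 (poch_ne_zero hγ n)
    have hg : 0 < ((γ.re : ℝ) : ℂ).re := by simpa using hγ
    have e1 : (((γ + n).re : ℝ) : ℂ) = (γ.re : ℂ) + n := by simp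
    have e2 : x ^ (σ.re + (γ + n).re - 1) = x ^ (σ.re + γ.re - 1) * x ^ n := by
      rw [← Real.rpow_add_natCast hx.ne']
      congr 1
      simp
      ring
    rw [e1, e2, Gamma_add_nat hg, norm_mul, norm_mul, norm_div, norm_inv, norm_pow, norm_real,
      Real.norm_of_nonneg hx.le, norm_cpow_eq_rpow_re_of_pos hx, neg_re,
      show γ + (((γ.re + σ.re : ℝ) : ℂ) - γ) + n = (σ.re : ℂ) + (γ.re + n) by push_cast; ring]
    -- Passing to real parts turns `Γ(γ + n)` into `Γ(Re γ + n)`, leaving the quotient `(Re γ)ₙ /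
    -- (γ)ₙ`, of norm at most `1`.
    have hle := norm_poch_re_le γ n
    simp only [norm_mul]
    set Γ' := ‖(Complex.Gamma ((σ.re : ℂ) + (γ.re + n)))⁻¹‖
    have hxn : 0 < x ^ n := by positivity
    calc _ = (‖poch γ.re n‖ / ‖poch γ n‖) * (x ^ (-α'.re) * x ^ (σ.re + γ.re - 1) *
          (‖Complex.Gamma σ.re‖ * ‖Complex.Gamma γ.re‖) * (‖c n‖ * Γ')) := by
          field_simp
      _ ≤ _ := mul_le_of_le_one_left (by positivity) ((div_le_one hp).2 hle)
  have hpt : ∀ t ∈ Set.Ioo 0 x, HasSum (fun n => F n t)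
      (((x - t : ℝ) : ℂ) ^ (γ - 1) * (t : ℂ) ^ (-α') *
        appellF3 α α' β β' γ (1 - (t : ℂ) / x) (1 - (x : ℂ) / t) * (t : ℂ) ^ (σ - 1)) := by
    intro t ht
    have hxt : (x : ℂ) - t ≠ 0 := by
      rw [← ofReal_sub]; exact ofReal_ne_zero.2 (sub_pos.2 ht.2).ne'
    have h := (appellF3_kernel α α' β β' hγ ht.1 ht.2).mul_left
      (((x : ℂ) - t) ^ (γ - 1) * (x : ℂ) ^ (-α') * (t : ℂ) ^ (σ - 1))
    have e : (x : ℂ) ^ (-α') * ((t : ℂ) / x) ^ (-α') = (t : ℂ) ^ (-α') := by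
      rw [← ofReal_div, ← mul_cpow_ofReal_nonneg hx.le (div_nonneg ht.1.le hx.le)]
      congr 1
      push_cast
      field_simp
    rw [hcoeff] at h
    convert! h using 1
    · ext n
      have e2 : 1 - (t : ℂ) / x = ((x : ℂ) - t) * (x : ℂ)⁻¹ := by field_simp
      simp only [F]
      rw [show γ + (n : ℂ) - 1 = (γ - 1) + n by ring, cpow_add _ _ hxt, cpow_natCast, e2, mul_pow,
        inv_pow]
      ring
    · rw [← e]
      push_cast
      ring
  obtain ⟨hi, hs⟩ := integrable_of_hasSum_of_summable_integral_norm hF hnorm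
    ((ae_restrict_mem measurableSet_Ioo).mono hpt)
  refine ⟨hi, hs.unique ?_⟩
  refine ((hS.2.mul_left (Complex.Gamma σ)).mul_left (Complex.Gamma γ)).mul_left
    ((x : ℂ) ^ (σ + γ - α' - 1)) |>.congr_fun fun n => ?_
  simp only [F]
  have hp := poch_ne_zero hγ n
  rw [integral_const_mul, setIntegral_beta hx h0 (hγn n), Gamma_add_nat hγ,
    show σ + (γ + n) - 1 = (σ + γ - 1) + n by ring, cpow_add _ _ hx', cpow_natCast,
    show σ + γ - α' - 1 = (σ + γ - 1) + (-α') by ring, cpow_add _ _ hx',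
    show γ + σ + n = σ + (γ + n) by ring]
  have hxn : (x : ℂ) ^ n ≠ 0 := pow_ne_zero _ hx'
  field_simp

/-! ### The `I`-function and the main theorem. -/

/-- With power one the determination of `log Γ` is immaterial. At the poles both sides take the
default value `0`. -/
lemma gammaPow_one {ℓ : ℂ → ℂ} (hℓ : IsLogGamma ℓ) (z : ℂ) :
    gammaPow ℓ 1 z = Complex.Gamma z := by
  unfold gammaPow
  split_ifs with h
  · obtain ⟨k, rfl⟩ := h
    exact (Gamma_neg_nat_eq_zero k).symm
  · push Not at h
    rw [ofReal_one, one_mul, hℓ z h]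

/-- Adjoining three upper parameters `(uᵢ, μ, 1)` at the front and three lower parameters
`(vᵢ, μ, 1)` at the end multiplies the Mellin-Barnes kernel by a quotient of Gamma functions. -/
lemma iKernel_vecCons_append {ℓ : ℂ → ℂ} (hℓ : IsLogGamma ℓ) {m n p q : ℕ} (hm : m ≤ q)
    (up : Fin p → ITriple) (lo : Fin q → ITriple) (u₁ u₂ u₃ v₁ v₂ v₃ : ℂ) (μ : ℝ) (s : ℂ) :
    iKernel ℓ m (n + 3)
      (Matrix.vecCons ⟨u₁, μ, 1⟩ (Matrix.vecCons ⟨u₂, μ, 1⟩ (Matrix.vecCons ⟨u₃, μ, 1⟩ up)))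
      (Fin.append lo ![⟨v₁, μ, 1⟩, ⟨v₂, μ, 1⟩, ⟨v₃, μ, 1⟩]) s =
    iKernel ℓ m n up lo s *
      (Complex.Gamma (1 - u₁ - μ * s) * Complex.Gamma (1 - u₂ - μ * s) *
        Complex.Gamma (1 - u₃ - μ * s) * (Complex.Gamma (1 - v₁ - μ * s))⁻¹ *
          (Complex.Gamma (1 - v₂ - μ * s))⁻¹ * (Complex.Gamma (1 - v₃ - μ * s))⁻¹) := by
  unfold iKernel
  rw [Fin.prod_univ_add, Fin.prod_univ_three, Fin.prod_univ_succ, Fin.prod_univ_succ,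
    Fin.prod_univ_succ]
  have h0 : ¬ q < m := by omega
  have h1 : ¬ q + 1 < m := by omega
  have h2 : ¬ q + 2 < m := by omega
  have e1 : (Fin.natAdd q (0 : Fin 3) : ℕ) = q := by simp
  have e2 : (Fin.natAdd q (1 : Fin 3) : ℕ) = q + 1 := by simp
  have e3 : (Fin.natAdd q (2 : Fin 3) : ℕ) = q + 2 := by simp
  have e4 : ∀ i : Fin p, ((i.succ.succ.succ : Fin (p + 3)) : ℕ) < n + 3 ↔ (i : ℕ) < n := by
    intro i; simp
  simp only [Fin.append_left, Fin.append_right, Fin.val_castAdd, e1, e2, e3, h0, h1, h2, if_false,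
    Matrix.cons_val_zero, Matrix.cons_val_succ, Matrix.cons_val_one, Matrix.cons_val, e4,
    gammaPow_one hℓ]
  rw [if_pos (by simp), if_pos (by simp),
    if_pos (by simpa using (Nat.mod_le _ _).trans_lt (by omega))]
  ring

lemma IAdmissible.vecCons_append {m n p q : ℕ} {up : Fin p → ITriple} {lo : Fin q → ITriple}
    (h : IAdmissible m n up lo 0) {u₁ u₂ u₃ : ℂ} (v₁ v₂ v₃ : ℂ) {μ : ℝ} (hμ : 0 < μ)
    (h₁ : 0 < (1 - u₁).re) (h₂ : 0 < (1 - u₂).re) (h₃ : 0 < (1 - u₃).re) :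
    IAdmissible m (n + 3)
      (Matrix.vecCons ⟨u₁, μ, 1⟩ (Matrix.vecCons ⟨u₂, μ, 1⟩ (Matrix.vecCons ⟨u₃, μ, 1⟩ up)))
      (Fin.append lo ![⟨v₁, μ, 1⟩, ⟨v₂, μ, 1⟩, ⟨v₃, μ, 1⟩]) 0 := by
  have key : ∀ u : ℂ, 0 < (1 - u).re → ∀ (k : ℕ) (s : ℂ), 1 - u - μ * s = -(k : ℂ) → 0 < s.re := by
    intro u hu k s hs
    have := congrArg re hs
    simp only [sub_re, re_ofReal_mul, neg_re, natCast_re] at this hu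
    have hk := k.cast_nonneg (α := ℝ)
    exact pos_of_mul_pos_right (a := μ) (by linarith) hμ.le
  refine ⟨h.le_q.trans (by omega), by have := h.le_p; omega, ?_, ?_, ?_, ?_, ?_, ?_⟩
  · refine Fin.cases hμ (Fin.cases hμ (Fin.cases hμ fun i => ?_))
    simpa using h.up_slope_pos i
  · refine Fin.cases one_pos (Fin.cases one_pos (Fin.cases one_pos fun i => ?_))
    simpa using h.up_power_pos i
  · refine Fin.addCases (fun j => ?_) (fun j => ?_)
    · simpa using h.lo_slope_pos j
    · fin_cases j <;> simpa using hμ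
  · refine Fin.addCases (fun j => ?_) (fun j => ?_)
    · simpa using h.lo_power_pos j
    · fin_cases j <;> simp
  · refine Fin.addCases (fun j hj => ?_) (fun j hj => ?_)
    · rw [Fin.append_left]
      exact h.left j (by simpa using hj)
    · have := h.le_q
      rw [Fin.val_natAdd] at hj
      omega
  · refine Fin.cases (fun _ => key _ h₁) (Fin.cases (fun _ => key _ h₂) (Fin.cases
      (fun _ => key _ h₃) fun i hi => ?_))
    simp only [Matrix.cons_val_succ]
    exact h.right i (by simpa using hi)

/-- A positive factor does not change the argument, so principal powers multiply. -/
lemma mul_ofReal_cpow {a : ℂ} (ha : a ≠ 0) {r : ℝ} (hr : 0 < r) (s : ℂ) :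
    (a * r) ^ s = a ^ s * (r : ℂ) ^ s := by
  have hr' : (r : ℂ) ≠ 0 := ofReal_ne_zero.2 hr.ne'
  rw [cpow_def_of_ne_zero (mul_ne_zero ha hr'), cpow_def_of_ne_zero ha, cpow_def_of_ne_zero hr',
    log_mul_ofReal r hr a ha, ofReal_log hr.le, ← exp_add]
  ring_nf

lemma rpow_ofReal_cpow {t : ℝ} (ht : 0 < t) (μ : ℝ) (s : ℂ) :
    ((t ^ μ : ℝ) : ℂ) ^ s = (t : ℂ) ^ (μ * s) := by
  rw [cpow_def_of_ne_zero (ofReal_ne_zero.2 (Real.rpow_pos_of_pos ht μ).ne'),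
    cpow_def_of_ne_zero (ofReal_ne_zero.2 ht.ne'), ← ofReal_log (Real.rpow_pos_of_pos ht μ).le,
    ← ofReal_log ht.le, Real.log_rpow ht]
  push_cast
  ring_nf

lemma ofReal_cpow_eq_exp {t : ℝ} (ht : 0 < t) (μ τ : ℝ) :
    (t : ℂ) ^ (-(μ * (τ * I))) = exp (((-(μ * τ * Real.log t) : ℝ) : ℂ) * I) := by
  rw [cpow_def_of_ne_zero (ofReal_ne_zero.2 ht.ne'), ← ofReal_log ht.le]
  push_cast
  ring_nf

lemma iIntegrand_mul_rpow (ℓ : ℂ → ℂ) (m n : ℕ) {p q : ℕ} (up : Fin p → ITriple)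
    (lo : Fin q → ITriple) {a : ℂ} (ha : a ≠ 0) {t : ℝ} (ht : 0 < t) (μ τ : ℝ) :
    iIntegrand ℓ m n up lo 0 (a * ((t ^ μ : ℝ) : ℂ)) τ =
      iIntegrand ℓ m n up lo 0 a τ * (t : ℂ) ^ (-(μ * (τ * I))) := by
  rw [iIntegrand, iIntegrand, mul_ofReal_cpow ha (Real.rpow_pos_of_pos ht μ), rpow_ofReal_cpow ht,
    ofReal_zero, zero_add, mul_neg]
  ring

theorem theorem3p1 (ℓ : ℂ → ℂ) (hℓ : IsLogGamma ℓ)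
    (m n p q : ℕ) (up : Fin p → ITriple) (lo : Fin q → ITriple)
    (α α' β β' γ ρ a : ℂ) (μ : ℝ) (hγ : 0 < γ.re) (hμ : 0 < μ)
    (hρ : max 0 (max (α' - β').re (α + α' + β - γ).re) < ρ.re)
    (ha : a ≠ 0)
    (hadm : IAdmissible m n up lo 0)
    (hconv : ∀ t : ℝ, 0 < t → IConverges ℓ m n up lo 0 (a * ((t ^ μ : ℝ) : ℂ)))
    (x : ℝ) (hx : 0 < x) :
    let up' : Fin (p + 3) → ITriple :=
      Matrix.vecCons ⟨1 - ρ, μ, 1⟩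
        (Matrix.vecCons ⟨1 + α' - β' - ρ, μ, 1⟩
          (Matrix.vecCons ⟨1 + α + α' + β - γ - ρ, μ, 1⟩ up))
    let lo' : Fin (q + 3) → ITriple :=
      Fin.append lo
        ![⟨1 - β' - ρ, μ, 1⟩, ⟨1 + α + α' - γ - ρ, μ, 1⟩, ⟨1 + α' + β - γ - ρ, μ, 1⟩]
    let f : ℝ → ℂ := fun t =>
      (t : ℂ) ^ (ρ - 1) * iFunction ℓ m n up lo 0 (a * ((t ^ μ : ℝ) : ℂ))
    IntervalIntegrable (msmLeftIntegrand α α' β β' γ f x) volume 0 x ∧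
    IAdmissible m (n + 3) up' lo' 0 ∧
    IConverges ℓ m (n + 3) up' lo' 0 (a * ((x ^ μ : ℝ) : ℂ)) ∧
    msmLeft α α' β β' γ f x =
      (x : ℂ) ^ (-α - α' + γ + ρ - 1) *
        iFunction ℓ m (n + 3) up' lo' 0 (a * ((x ^ μ : ℝ) : ℂ)) := by
  intro up' lo' f
  simp only [max_lt_iff] at hρ
  obtain ⟨h0, h1, h2⟩ := hρ
  have hx' : (x : ℂ) ≠ 0 := ofReal_ne_zero.2 hx.ne'
  have hΓ := Gamma_ne_zero_of_re_pos hγ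
  have hadm' : IAdmissible m (n + 3) up' lo' 0 := by
    refine hadm.vecCons_append _ _ _ hμ ?_ ?_ ?_
    · simpa using h0
    · simp only [sub_re, add_re, one_re] at h1 ⊢; linarith
    · simp only [sub_re, add_re, one_re] at h2 ⊢; linarith
  let K : ℝ → ℂ := fun t => ((x - t : ℝ) : ℂ) ^ (γ - 1) * (t : ℂ) ^ (-α') *
      appellF3 α α' β β' γ (1 - (t : ℂ) / x) (1 - (x : ℂ) / t)
  let h : ℝ → ℂ := iIntegrand ℓ m n up lo 0 a
  let e : ℝ → ℝ → ℂ := fun t τ => exp (((-(μ * τ * Real.log t) : ℝ) : ℂ) * I)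
  let J : ℝ × ℝ → ℂ := fun z => e z.1 z.2 * (K z.1 * (z.1 : ℂ) ^ (ρ - 1) * h z.2)
  -- Convergence at `t = 1` suffices, since the modulus of the integrand does not depend on `t`.
  have hh : Integrable h := by simpa [IConverges] using hconv 1 one_pos
  have hK := (integrableOn_msm_cpow α α' β β' hγ h0 h1 h2 hx).1
  have hJ : Integrable J ((volume.restrict (Set.Ioo 0 x)).prod volume) := by
    refine (Integrable.mul_prod hK hh).bdd_mul (c := 1) ?_ (Eventually.of_forall fun z => ?_)
    · have : Measurable fun z : ℝ × ℝ => e z.1 z.2 := by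
        simp only [e]
        fun_prop
      exact this.aestronglyMeasurable
    · simp only [e, norm_exp_ofReal_mul_I, le_refl]
  have hf : ∀ t ∈ Set.Ioo 0 x, (1 / (2 * (Real.pi : ℂ) * I) * I) * ∫ τ, J (t, τ) =
      msmLeftIntegrand α α' β β' γ f x t := by
    intro t ht
    have e1 : ∀ τ, J (t, τ) = K t * (t : ℂ) ^ (ρ - 1) *
        iIntegrand ℓ m n up lo 0 (a * ((t ^ μ : ℝ) : ℂ)) τ := by
      intro τ
      rw [iIntegrand_mul_rpow ℓ m n up lo ha ht.1, ofReal_cpow_eq_exp ht.1]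
      simp only [J, e, h]
      ring
    simp only [e1, msmLeftIntegrand, f, iFunction, K]
    rw [integral_const_mul, integral_mul_const]
    ring
  -- Integrating over `t` first gives a nonzero constant times the new `I`-function integrand, so
  -- its absolute convergence is part of Fubini's theorem.
  have hJx : ∀ τ, ∫ t in Set.Ioo 0 x, J (t, τ) = Complex.Gamma γ * (x : ℂ) ^ (ρ + γ - α' - 1) *
      iIntegrand ℓ m (n + 3) up' lo' 0 (a * ((x ^ μ : ℝ) : ℂ)) τ := by
    intro τ
    set σ : ℂ := ρ - μ * (τ * I) with hσ
    have hre : σ.re = ρ.re := by simp [hσ]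
    have hI := (integrableOn_msm_cpow α α' β β' (σ := σ) hγ (by rwa [hre]) (by rwa [hre])
      (by rwa [hre]) hx).2
    have e1 : ∫ t in Set.Ioo 0 x, J (t, τ) = ∫ t in Set.Ioo 0 x, h τ * (K t * (t : ℂ) ^ (σ - 1)) := by
      refine setIntegral_congr_fun measurableSet_Ioo fun t ht => ?_
      dsimp only [J, e]
      rw [← ofReal_cpow_eq_exp ht.1, show σ - 1 = (ρ - 1) + -(μ * (τ * I)) by rw [hσ]; ring,
        cpow_add _ _ (ofReal_ne_zero.2 ht.1.ne')]
      ring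
    rw [e1, integral_const_mul, hI, iIntegrand_mul_rpow _ _ _ _ _ ha hx, iIntegrand,
      iKernel_vecCons_append hℓ hadm.le_q, kernelMellin,
      show σ + γ - α' - 1 = (ρ + γ - α' - 1) + -(μ * (τ * I)) by rw [hσ]; ring, cpow_add _ _ hx',
      show 1 - (1 - ρ) - μ * (((0 : ℝ) : ℂ) + τ * I) = σ by rw [hσ]; push_cast; ring,
      show 1 - (1 + α' - β' - ρ) - μ * (((0 : ℝ) : ℂ) + τ * I) = σ + (β' - α') by
        rw [hσ]; push_cast; ring,
      show 1 - (1 + α + α' + β - γ - ρ) - μ * (((0 : ℝ) : ℂ) + τ * I) = σ + (γ - α - α' - β) by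
        rw [hσ]; push_cast; ring,
      show 1 - (1 - β' - ρ) - μ * (((0 : ℝ) : ℂ) + τ * I) = σ + β' by rw [hσ]; push_cast; ring,
      show 1 - (1 + α + α' - γ - ρ) - μ * (((0 : ℝ) : ℂ) + τ * I) = σ + (γ - α - α') by
        rw [hσ]; push_cast; ring,
      show 1 - (1 + α' + β - γ - ρ) - μ * (((0 : ℝ) : ℂ) + τ * I) = σ + (γ - α' - β) by
        rw [hσ]; push_cast; ring]
    simp only [h, iIntegrand]
    ring
  have hconst : Complex.Gamma γ * (x : ℂ) ^ (ρ + γ - α' - 1) ≠ 0 :=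
    mul_ne_zero hΓ (by simp [cpow_eq_zero_iff, hx'])
  refine ⟨?_, hadm', ?_, ?_⟩
  · rw [intervalIntegrable_iff_integrableOn_Ioo_of_le hx.le]
    exact IntegrableOn.congr_fun (hJ.integral_prod_left.const_mul _) hf measurableSet_Ioo
  · have := hJ.integral_prod_right
    simp only [hJx] at this
    exact (integrable_const_mul_iff (isUnit_iff_ne_zero.2 hconst) _).1 this
  · have swap := integral_integral_swap (f := fun t τ => J (t, τ)) hJ
    simp only [hJx] at swap
    rw [integral_const_mul] at swap
    rw [msmLeft, intervalIntegral.integral_of_le hx.le, integral_Ioc_eq_integral_Ioo,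
      ← setIntegral_congr_fun measurableSet_Ioo hf, integral_const_mul, swap, iFunction,
      integral_mul_const, show -α - α' + γ + ρ - 1 = (-α) + (ρ + γ - α' - 1) by ring,
      cpow_add _ _ hx']
    field_simp
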